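/- Let $M$ be a smooth finite-dimensional Hausdorff manifold without boundary and let $\mathcal G\subset T^*M$ be an open neighbourhood of the zero section, with cotangent projection $\tau\colon\mathcal G\to M$ and canonical symplectic form $\omega=d(p\,dx)$ (for instance the realization in $T^*M$ of a local symplectic groupoid of a Poisson structure on $M$). For one-forms $a,b$ on $\mathcal G$ let $X_a$ be the vector field with $\omega(\cdot,X_a)=a$, and let $$[a,b]=\mathcal L_{X_a}b-\mathcal L_{X_b}a-d\,\omega(X_a,X_b).$$ Let $Z$ be the set of smooth closed one-forms $\zeta$ on $M$ whose graph is contained in $\mathcal G$; each $\zeta\in Z$ is regarded as a section $M\to\mathcal G$. For families $f=(f_\zeta)_{\zeta\in Z}$, $g=(g_\zeta)_{\zeta\in Z}$ of one-forms on $\mathcal G$ put $$\eta(f,g)_\zeta=[f_\zeta,\tau^*\zeta^*g_\zeta].$$ Let $\xi\in\Omega^1(\mathcal G)$ be smooth, viewed as a constant family, and let $J_\xi^\infty$ be the smallest real vector space of families that contains $\xi$ and is stable under $\eta$. The product $\triangleright$ is given by the rules: $\triangleright$ is bilinear and $$h\triangleright\xi=\eta(\xi,h),\qquad h\triangleright\eta(f,g)=\eta(h\triangleright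 f,g)+\eta(f,h\triangleright g).$$ Then: 1. For every $f\in J_\xi^\infty$ and $\zeta\in Z$ the one-form $f_\zeta$ on $\mathcal G$ is smooth. Every element of $J_\xi^\infty$ is the value of a formal expression built from $\xi$ by $\eta$, sums and real multiples. 2. On formal expressions let $\triangleright$ be defined by the rules above, by recursion on the right factor (and linearly in sums and multiples in the right factor). Then for all expressions $f,g,h$ the identity $$(f\triangleright g)\triangleright h-f\triangleright(g\triangleright h)=(g\triangleright f)\triangleright h-g\triangleright(f\triangleright h)\qquad(*)$$ holds between the elements of $J_\xi^\infty$ that the four terms denote. 3. Every bilinear product $\triangleright$ on $J_\xi^\infty$ that obeys the two rules satisfies $(*)$ for all $f,g,h\in J_\xi^\infty$, that is, $(J_\xi^\infty,\triangleright)$ is a (left) pre-Lie algebra. 4. If $\xi$ is closed (so that $\zeta\mapsto\zeta^*\eta(f,g)_\zeta$ takes values in closed one-forms), there is exactly one bilinear product on $J_\xi^\infty$ that obeys the two rules. Hence $(J_\xi^\infty,\triangleright)$ is then a pre-Lie algebra. -/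

import Mathlib

open scoped Manifold ContDiff Bundle
open TopologicalSpace

noncomputable section

/-! ### One-forms on a manifold without boundary -/

section Forms

variable {F : Type*} [NormedAddCommGroup F] [NormedSpace ℝ F]
  {H : Type*} [TopologicalSpace H] (J : ModelWithCorners ℝ F H)
  (N : Type*) [TopologicalSpace N] [ChartedSpace H N]

/-- The cotangent space of `N` at `q`. -/
abbrev CotangentSpace {N : Type*} [TopologicalSpace N] [ChartedSpace H N] (q : N) :=
  TangentSpace J q →L[ℝ] Bundle.Trivial N ℝ q

/-- Not necessarily smooth one-forms on `N`: a covector at each point. -/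
abbrev RoughOneForm := (q : N) → CotangentSpace J q

variable {N} {J}

/-- A one-form is smooth if it is a smooth section of the cotangent bundle. -/
def IsSmoothOneForm [IsManifold J ∞ N] (a : RoughOneForm J N) : Prop :=
  ContMDiff J (J.prod 𝓘(ℝ, F →L[ℝ] ℝ)) ∞
    (fun q => (Bundle.TotalSpace.mk q (a q) :
      Bundle.TotalSpace (F →L[ℝ] ℝ) (fun q : N => CotangentSpace J q)))

/-- The expression of the one-form `a` in the preferred chart at `q`, that is, its pull-back
by the inverse of this chart. -/
def chartForm (a : RoughOneForm J N) (q : N) : F → F →L[ℝ] ℝ := fun y =>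
  (a ((extChartAt J q).symm y)).comp (mfderiv 𝓘(ℝ, F) J (extChartAt J q).symm y)

/-- The exterior derivative of a one-form on a manifold without boundary, as a field of bilinear
forms. It is computed in the preferred chart `φ` at `q`: if `b` is the one-form in the chart, then
`da (u, v) = (D b (Dφ u)) (Dφ v) - (D b (Dφ v)) (Dφ u)`. -/
def extDerivOneForm (a : RoughOneForm J N) (q : N) :
    TangentSpace J q →L[ℝ] TangentSpace J q →L[ℝ] ℝ :=
  let A : F →L[ℝ] F →L[ℝ] ℝ := fderiv ℝ (chartForm a q) (extChartAt J q q)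
  let D : F →L[ℝ] F := mfderiv J 𝓘(ℝ, F) (extChartAt J q) q
  ((A - A.flip).bilinearComp D D : F →L[ℝ] F →L[ℝ] ℝ)

/-- A one-form is closed if its exterior derivative vanishes. -/
def IsClosedOneForm (a : RoughOneForm J N) : Prop :=
  ∀ q, extDerivOneForm a q = 0

/-- The differential of a function, as a one-form. -/
def diffFun (f : N → ℝ) : RoughOneForm J N := fun q => mvfderiv J f q

/-- The Lie derivative of a one-form along a vector field: `L_X b = d (b X) + (db) (X, ·)`. -/
def lieDerivOneForm (X : (q : N) → TangentSpace J q) (b : RoughOneForm J N) :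
    RoughOneForm J N := fun q =>
  diffFun (J := J) (fun r => (b r (X r) : ℝ)) q + extDerivOneForm b q (X q)

/-- The pull-back of a one-form by a map. -/
def pullbackOneForm {F' : Type*} [NormedAddCommGroup F'] [NormedSpace ℝ F']
    {H' : Type*} [TopologicalSpace H'] {J' : ModelWithCorners ℝ F' H'}
    {N' : Type*} [TopologicalSpace N'] [ChartedSpace H' N']
    (φ : N' → N) (a : RoughOneForm J N) : RoughOneForm J' N' := fun x =>
  (a (φ x)).comp (mfderiv J' J φ x)

end Forms

/-! ### Open subsets of the cotangent bundle -/

section Cotangent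

variable (E : Type*) [NormedAddCommGroup E] [NormedSpace ℝ E]
  (M : Type*) [TopologicalSpace M] [ChartedSpace E M] [IsManifold 𝓘(ℝ, E) ∞ M]

/-- The cotangent bundle `T^*M`. -/
abbrev CotangentBundle :=
  Bundle.TotalSpace (E →L[ℝ] ℝ) (fun x : M => CotangentSpace 𝓘(ℝ, E) x)

/-- The model with corners of the manifold `T^*M`. -/
abbrev cotangentModel : ModelWithCorners ℝ (E × (E →L[ℝ] ℝ)) (ModelProd E (E →L[ℝ] ℝ)) :=
  (𝓘(ℝ, E)).prod 𝓘(ℝ, E →L[ℝ] ℝ)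

variable {E M} (G : Opens (CotangentBundle E M))

/-- One-forms on the open subset `G` of `T^*M`. -/
abbrev FormOn := RoughOneForm (cotangentModel E) G

variable {G}

/-- The restriction `τ : G → M` of the cotangent projection. -/
def cotProj (q : G) : M := q.1.proj

/-- The tautological (Liouville) one-form `p dx` on `G`. -/
def tautologicalForm : FormOn G := fun q =>
  q.1.2.comp (mfderiv (cotangentModel E) 𝓘(ℝ, E) (cotProj (G := G)) q)

/-- The canonical symplectic form `ω = dp ∧ dx` on `G`. -/
def canonicalSymplectic (q : G) :
    TangentSpace (cotangentModel E) q →L[ℝ] TangentSpace (cotangentModel E) q →L[ℝ] ℝ :=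
  extDerivOneForm tautologicalForm q

/-- The vector field `X_a` generated by the one-form `a` through `ω (X_a, ·) = -a`. For `a = df`
it is the Hamiltonian vector field of `f`, with `ω (X_f, X_g) = X_f g`. -/
def symplecticField (a : FormOn G) (q : G) : TangentSpace (cotangentModel E) q :=
  (canonicalSymplectic q).inverse (-(a q))

/-- The Lie algebroid bracket of one-forms on `G`:
`[a, b] = L_{X_a} b - L_{X_b} a - d (ω (X_a, X_b))`. -/
def formBracket (a b : FormOn G) : FormOn G :=
  lieDerivOneForm (symplecticField a) b - lieDerivOneForm (symplecticField b) a
    - diffFun (fun q => canonicalSymplectic q (symplecticField a q) (symplecticField b q))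

variable (G)

/-- The smooth closed one-forms `ζ` on `M` whose graph is contained in `G`. -/
structure ClosedFormIn where
  /-- the one-form on `M` -/
  form : RoughOneForm 𝓘(ℝ, E) M
  smooth : IsSmoothOneForm form
  closed : IsClosedOneForm form
  graph_mem : ∀ x, Bundle.TotalSpace.mk x (form x) ∈ G

variable {G}

/-- The section `M → G` defined by `ζ`. -/
def ClosedFormIn.toSection (ζ : ClosedFormIn G) (x : M) : G :=
  ⟨Bundle.TotalSpace.mk x (ζ.form x), ζ.graph_mem x⟩

variable (G)

/-- One-forms on `G` depending on a closed one-form `ζ` on `M` with graph in `G`. -/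
abbrev FormFamily := ClosedFormIn G → FormOn G

variable {G}

/-- The operation `η`: `η (f, g)` at `ζ` is `[f, τ^* ζ^* g]`, where `f` and `g` are taken
at `ζ`. -/
def etaOp (f g : FormFamily G) : FormFamily G := fun ζ =>
  formBracket (f ζ) (pullbackOneForm cotProj
    (pullbackOneForm (J' := 𝓘(ℝ, E)) ζ.toSection (g ζ)))

/-- A one-form on `G`, as a family that does not depend on `ζ`. -/
def constFamily (ξ : FormOn G) : FormFamily G := fun _ => ξ

/-- The real vector space `J_ξ^∞`: the smallest space of families that contains `ξ` and is
stable under `η`. -/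
def jetSpace (ξ : FormOn G) : Submodule ℝ (FormFamily G) :=
  sInf {p | constFamily ξ ∈ p ∧ ∀ f ∈ p, ∀ g ∈ p, etaOp f g ∈ p}

theorem constFamily_mem_jetSpace (ξ : FormOn G) : constFamily ξ ∈ jetSpace ξ :=
  Submodule.mem_sInf.2 fun _ hp => hp.1

theorem etaOp_mem_jetSpace {ξ : FormOn G} {f g : FormFamily G}
    (hf : f ∈ jetSpace ξ) (hg : g ∈ jetSpace ξ) : etaOp f g ∈ jetSpace ξ :=
  Submodule.mem_sInf.2 fun p hp =>
    hp.2 f (Submodule.mem_sInf.1 hf p hp) g (Submodule.mem_sInf.1 hg p hp)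

/-- The generator `ξ` of `J_ξ^∞`. -/
def jetSpace.gen (ξ : FormOn G) : jetSpace ξ := ⟨constFamily ξ, constFamily_mem_jetSpace ξ⟩

/-- The operation `η` on `J_ξ^∞`. -/
def jetSpace.eta {ξ : FormOn G} (f g : jetSpace ξ) : jetSpace ξ :=
  ⟨etaOp f.1 g.1, etaOp_mem_jetSpace f.2 g.2⟩

/-- The rules that define the product `h ▷ f = T h f` on `J_ξ^∞`:
`h ▷ ξ = η (ξ, h)` and `h ▷ η (f, g) = η (h ▷ f, g) + η (f, h ▷ g)`. -/
def IsTriangleProduct {ξ : FormOn G} (T : jetSpace ξ →ₗ[ℝ] jetSpace ξ →ₗ[ℝ] jetSpace ξ) : Prop :=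
  (∀ h, T h (jetSpace.gen ξ) = jetSpace.eta (jetSpace.gen ξ) h) ∧
    ∀ h f g, T h (jetSpace.eta f g) = jetSpace.eta (T h f) g + jetSpace.eta f (T h g)

end Cotangent

/-! ### Formal expressions -/

/-- Formal expressions in one generator `ξ`, the operation `η` and linear combinations. -/
inductive JetExpr : Type
  | gen : JetExpr
  | eta : JetExpr → JetExpr → JetExpr
  | add : JetExpr → JetExpr → JetExpr
  | smul : ℝ → JetExpr → JetExpr

namespace JetExpr

/-- The product `h ▷ f` of formal expressions, by recursion on `f`. -/
def tri (h : JetExpr) : JetExpr → JetExpr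
  | gen => eta gen h
  | eta f g => add (eta (tri h f) g) (eta f (tri h g))
  | add f g => add (tri h f) (tri h g)
  | smul c f => smul c (tri h f)

variable {E : Type*} [NormedAddCommGroup E] [NormedSpace ℝ E]
  {M : Type*} [TopologicalSpace M] [ChartedSpace E M] [IsManifold 𝓘(ℝ, E) ∞ M]
  {G : Opens (CotangentBundle E M)}

/-- The element of `J_ξ^∞` denoted by a formal expression. -/
def eval (ξ : FormOn G) : JetExpr → jetSpace ξ
  | gen => jetSpace.gen ξ
  | eta f g => jetSpace.eta (eval ξ f) (eval ξ g)
  | add f g => eval ξ f + eval ξ g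
  | smul c f => c • eval ξ f

end JetExpr

end

noncomputable section

open scoped Topology

set_option synthInstance.maxHeartbeats 200000

/-! ### One-forms and their exterior derivative in charts -/

section FormsInCharts

variable {F : Type*} [NormedAddCommGroup F] [NormedSpace ℝ F]
  {H : Type*} [TopologicalSpace H] {J : ModelWithCorners ℝ F H}
  {N : Type*} [TopologicalSpace N] [ChartedSpace H N]

section Boundaryless

/-! The symplectic form turns one-forms on `G` into vector fields. In cotangent charts it is the
constant form `flatOmega`, and there the bracket of one-forms becomes the Lie bracket of vector
fields (`chartField_formBracket`). A form `τ^* ζ^* g` becomes a vertical field that is constant on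
the fibres. Two such fields commute, so the Jacobi identity gives `η (η (u, f), g) = η (η (u, g),
f)` (`formBracket_basicPart_comm`).

This symmetry is all that the pre-Lie identity needs. Write `A(f, g, h)` for the associator `(f ▷ g)
▷ h - f ▷ (g ▷ h)`. For `h = ξ` it equals `-η (η (ξ, f), g)`, which is symmetric in `f` and `g`. The
difference `A(f, g, ·) - A(g, f, ·)` is a derivation of `η`, since the mixed terms of `A(f, g, ·)`
are symmetric. It therefore vanishes on everything generated by `ξ` (`JetExpr.evalIn_preLie`).

Existence of the product on values is a different matter: `h ▷ e` must depend on the expression `e`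
only through its value. For closed `ξ` the form `ζ^* h_ζ` is closed, and `h ▷ e` is the derivative
at `t = 0` of the family `e` along `ζ + t ζ^* h_ζ`, transported back by the translation of the
fibres by `t ζ^* h_ζ`. Infinitesimally this is the Lie derivative along `(1, 0, d)` on `ℝ × E × P`,
where `d` is the direction in the chart. It is a derivation of the bracket by the Jacobi identity.
It commutes with `g ↦ τ^* ζ^* g`, because the flow permutes the graphs of `ζ + t d`. On the constant
family `ξ` it gives `η (ξ, h)`. So it obeys the rules of `▷` (`JetExpr.shiftDeriv_timeField`), while
by construction it sees only the family.

The curve of closed forms must stay in `G`. As only the germ at one point matters, `ζ^* h_ζ` is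
first replaced by a compactly supported closed form with the same germ, by the Poincaré lemma and a
bump function (`exists_isClosedOneForm_eventuallyEq`). -/

theorem eventually_mem_extChartAt_target [J.Boundaryless] (q : N) {y : F}
    (hy : y ∈ (extChartAt J q).target) :
    ∀ᶠ z in 𝓝 y, z ∈ (extChartAt J q).target :=
  (isOpen_extChartAt_target q).mem_nhds hy

variable [IsManifold J ∞ N]

theorem contMDiffAt_extChartAt_of_mem (q : N) {r : N} (hr : r ∈ (extChartAt J q).source) :
    ContMDiffAt J 𝓘(ℝ, F) ∞ (extChartAt J q) r :=
  contMDiffAt_extChartAt' (by simpa using hr)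

theorem mdifferentiableAt_extChartAt_of_mem (q : N) {r : N} (hr : r ∈ (extChartAt J q).source) :
    MDifferentiableAt J 𝓘(ℝ, F) (extChartAt J q) r :=
  (contMDiffAt_extChartAt_of_mem q hr).mdifferentiableAt (by simp)

/-- Differentials of non-differentiable functions are zero by convention, so differentiability has
to be brought back from the chart before `diffFun` can be computed there. -/
theorem mdifferentiableAt_of_comp_symm {f : N → ℝ} {q : N} {y : F}
    (hy : y ∈ (extChartAt J q).target)
    (hf : DifferentiableAt ℝ (f ∘ (extChartAt J q).symm) y) :
    MDifferentiableAt J 𝓘(ℝ, ℝ) f ((extChartAt J q).symm y) := by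
  have hs := (extChartAt J q).map_target hy
  have h := (show MDifferentiableAt 𝓘(ℝ, F) 𝓘(ℝ, ℝ) (f ∘ (extChartAt J q).symm)
    (extChartAt J q ((extChartAt J q).symm y)) from by
      rw [(extChartAt J q).right_inv hy]; exact hf.mdifferentiableAt).comp _
    (mdifferentiableAt_extChartAt_of_mem q hs)
  refine h.congr_of_eventuallyEq ?_
  filter_upwards [(isOpen_extChartAt_source q).mem_nhds hs] with z hz
  exact congrArg f ((extChartAt J q).left_inv hz).symm

variable [J.Boundaryless]

theorem contMDiffAt_extChartAt_symm_of_mem (q : N) {y : F} (hy : y ∈ (extChartAt J q).target) :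
    ContMDiffAt 𝓘(ℝ, F) J ∞ (extChartAt J q).symm y :=
  (contMDiffOn_extChartAt_symm q).contMDiffAt ((isOpen_extChartAt_target q).mem_nhds hy)

theorem mdifferentiableAt_extChartAt_symm_of_mem (q : N) {y : F}
    (hy : y ∈ (extChartAt J q).target) :
    MDifferentiableAt 𝓘(ℝ, F) J (extChartAt J q).symm y :=
  (contMDiffAt_extChartAt_symm_of_mem q hy).mdifferentiableAt (by simp)

theorem mfderiv_extChartAt_comp_symm (q : N) {y : F} (hy : y ∈ (extChartAt J q).target) :
    (mfderiv J 𝓘(ℝ, F) (extChartAt J q) ((extChartAt J q).symm y)) ∘L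
      (mfderiv 𝓘(ℝ, F) J (extChartAt J q).symm y) = ContinuousLinearMap.id _ _ := by
  have := mfderiv_extChartAt_comp_mfderivWithin_extChartAt_symm hy
  rwa [J.range_eq_univ, mfderivWithin_univ] at this

theorem mfderiv_extChartAt_symm_comp (q : N) {y : F} (hy : y ∈ (extChartAt J q).target) :
    (mfderiv 𝓘(ℝ, F) J (extChartAt J q).symm y) ∘L
      (mfderiv J 𝓘(ℝ, F) (extChartAt J q) ((extChartAt J q).symm y)) =
        ContinuousLinearMap.id _ _ := by
  have := mfderivWithin_extChartAt_symm_comp_mfderiv_extChartAt hy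
  rwa [J.range_eq_univ, mfderivWithin_univ] at this

theorem mfderiv_extChartAt_mfderiv_symm_apply (q : N) {y : F} (hy : y ∈ (extChartAt J q).target)
    (v : F) :
    mfderiv J 𝓘(ℝ, F) (extChartAt J q) ((extChartAt J q).symm y)
      (mfderiv 𝓘(ℝ, F) J (extChartAt J q).symm y v) = v :=
  DFunLike.congr_fun (mfderiv_extChartAt_comp_symm q hy) v

theorem mfderiv_symm_mfderiv_extChartAt_apply (q : N) {y : F} (hy : y ∈ (extChartAt J q).target)
    (v : TangentSpace J ((extChartAt J q).symm y)) :
    mfderiv 𝓘(ℝ, F) J (extChartAt J q).symm y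
      (mfderiv J 𝓘(ℝ, F) (extChartAt J q) ((extChartAt J q).symm y) v) = v :=
  DFunLike.congr_fun (mfderiv_extChartAt_symm_comp q hy) v

/-- The value of a one-form, in terms of its expression in a chart. -/
theorem apply_eq_chartForm (a : RoughOneForm J N) (q : N) {y : F}
    (hy : y ∈ (extChartAt J q).target) (v : TangentSpace J ((extChartAt J q).symm y)) :
    (a ((extChartAt J q).symm y) v : ℝ) =
      chartForm a q y (mfderiv J 𝓘(ℝ, F) (extChartAt J q) ((extChartAt J q).symm y) v) := by
  change _ = a ((extChartAt J q).symm y) _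
  congr 1
  exact (mfderiv_symm_mfderiv_extChartAt_apply q hy v).symm

theorem eq_of_chartForm_eq {a b : RoughOneForm J N} {q : N}
    (h : chartForm a q (extChartAt J q q) = chartForm b q (extChartAt J q q)) : a q = b q := by
  have hy := mem_extChartAt_target (I := J) q
  have key : a ((extChartAt J q).symm (extChartAt J q q)) =
      b ((extChartAt J q).symm (extChartAt J q q)) := by
    ext v
    have h1 := apply_eq_chartForm a q hy v
    rw [h] at h1
    exact h1.trans (apply_eq_chartForm b q hy v).symm
  rwa [extChartAt_to_inv] at key

theorem roughOneForm_ext {a b : RoughOneForm J N}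
    (h : ∀ q, ∀ y ∈ (extChartAt J q).target, chartForm a q y = chartForm b q y) : a = b :=
  funext fun q => eq_of_chartForm_eq (h q _ (mem_extChartAt_target q))

/-- The trivialization of the tangent bundle over the chart at `q` has the derivative of the inverse
chart as its inverse, so the dual trivialization is the pull-back by the inverse chart. This links
smoothness of sections, and the charts of `T^*M`, to `chartForm`. -/
theorem inCoordinates_eq_chartForm (a : RoughOneForm J N) (q : N) {r : N}
    (hr : r ∈ (extChartAt J q).source) :
    ((trivializationAt (F →L[ℝ] ℝ) (fun q : N => CotangentSpace J q) q)
      (Bundle.TotalSpace.mk r (a r))).2 = chartForm a q (extChartAt J q r) := by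
  rw [hom_trivializationAt_apply]
  have h := TangentBundle.symmL_trivializationAt (I := J) (x₀ := q) (x := r) (by simpa using hr)
  rw [J.range_eq_univ, mfderivWithin_univ] at h
  have hl := (extChartAt J q).left_inv hr
  ext v
  -- All tangent spaces are definitionally `F`, so a covector can be moved between equal base points
  -- without a cast.
  have key : ∀ r', r' = r → ∀ w : F, (a r w : ℝ) = a r' w := by rintro _ rfl w; rfl
  simp only [chartForm, ContinuousLinearMap.inCoordinates, h]
  simp
  exact key _ hl _

theorem isSmoothOneForm_iff {a : RoughOneForm J N} :
    IsSmoothOneForm a ↔ ∀ q, ContDiffOn ℝ ∞ (chartForm a q) (extChartAt J q).target := by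
  have key : ∀ q : N, ContMDiffOn J (J.prod 𝓘(ℝ, F →L[ℝ] ℝ)) ∞
      (fun q => (Bundle.TotalSpace.mk q (a q) :
        Bundle.TotalSpace (F →L[ℝ] ℝ) (fun q : N => CotangentSpace J q))) (extChartAt J q).source ↔
      ContDiffOn ℝ ∞ (chartForm a q) (extChartAt J q).target := by
    intro q
    have hb : (extChartAt J q).source ⊆
        (trivializationAt (F →L[ℝ] ℝ) (fun q : N => CotangentSpace J q) q).baseSet := by
      intro r hr
      simpa using hr
    rw [(trivializationAt (F →L[ℝ] ℝ)
      (fun q : N => CotangentSpace J q) q).contMDiffOn_section_iff (isOpen_extChartAt_source q) hb,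
      ← contMDiffOn_iff_contDiffOn]
    have hs : (extChartAt J q).source = (chartAt H q).source := extChartAt_source J q
    constructor
    · intro h
      refine (h.comp (contMDiffOn_extChartAt_symm q)
        (fun y hy => (extChartAt J q).map_target hy)).congr fun y hy => ?_
      simp only [Function.comp]
      rw [inCoordinates_eq_chartForm a q ((extChartAt J q).map_target hy),
        (extChartAt J q).right_inv hy]
    · intro h
      refine (h.comp (hs ▸ contMDiffOn_extChartAt (x := q))
        (fun y hy => (extChartAt J q).map_source hy)).congr fun y hy => ?_
      exact inCoordinates_eq_chartForm a q hy
  constructor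
  · exact fun h q => (key q).1 h.contMDiffOn
  · intro h q
    exact ((key q).2 (h q)).contMDiffAt
      ((isOpen_extChartAt_source q).mem_nhds (mem_extChartAt_source q))

theorem IsSmoothOneForm.contDiffAt {a : RoughOneForm J N} (ha : IsSmoothOneForm a) (q : N) {y : F}
    (hy : y ∈ (extChartAt J q).target) : ContDiffAt ℝ ∞ (chartForm a q) y :=
  (isSmoothOneForm_iff.1 ha q).contDiffAt ((isOpen_extChartAt_target q).mem_nhds hy)

end Boundaryless

/-- The exterior derivative of a one-form on a normed space. -/
def flatCurl (A : F → F →L[ℝ] ℝ) (y : F) : F →L[ℝ] F →L[ℝ] ℝ :=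
  fderiv ℝ A y - (fderiv ℝ A y).flip

theorem flatCurl_apply (A : F → F →L[ℝ] ℝ) (y u v : F) :
    flatCurl A y u v = fderiv ℝ A y u v - fderiv ℝ A y v u := rfl

theorem Filter.EventuallyEq.flatCurl_eq {A B : F → F →L[ℝ] ℝ} {y : F} (h : A =ᶠ[𝓝 y] B) :
    flatCurl A y = flatCurl B y := by
  simp only [flatCurl, h.fderiv_eq]

/-- The exterior derivative commutes with pull-backs on normed spaces. -/
theorem flatCurl_pullback {F' : Type*} [NormedAddCommGroup F'] [NormedSpace ℝ F']
    {A : F' → F' →L[ℝ] ℝ} {f : F → F'} {y : F} (hA : DifferentiableAt ℝ A (f y))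
    (hf : ContDiffAt ℝ 2 f y) (u v : F) :
    flatCurl (fun z => (A (f z)).comp (fderiv ℝ f z)) y u v =
      flatCurl A (f y) (fderiv ℝ f y u) (fderiv ℝ f y v) := by
  have hf1 : DifferentiableAt ℝ f y := hf.differentiableAt (by simp)
  have hf2 : DifferentiableAt ℝ (fderiv ℝ f) y :=
    (hf.fderiv_right (m := 1) (by norm_num)).differentiableAt (by simp)
  -- The terms with the second derivative of `f` cancel by its symmetry.
  have hsymm : IsSymmSndFDerivAt ℝ f y := hf.isSymmSndFDerivAt (by simp)
  have hd : HasFDerivAt (fun z => (A (f z)).comp (fderiv ℝ f z)) _ y :=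
    (hA.hasFDerivAt.comp y hf1.hasFDerivAt).clm_comp hf2.hasFDerivAt
  rw [flatCurl_apply, hd.fderiv, flatCurl_apply]
  simp [hsymm.eq u v]

variable [J.Boundaryless] [IsManifold J ∞ N]

theorem contDiffAt_extChartAt_comp_symm {q r : N} {y : F} (hy : y ∈ (extChartAt J q).target)
    (hr : (extChartAt J q).symm y ∈ (extChartAt J r).source) :
    ContDiffAt ℝ ∞ (extChartAt J r ∘ (extChartAt J q).symm) y := by
  rw [← contMDiffAt_iff_contDiffAt]
  exact (contMDiffAt_extChartAt_of_mem r hr).comp y (contMDiffAt_extChartAt_symm_of_mem q hy)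

/-- The expression of a pull-back in charts. -/
theorem chartForm_pullback {F' : Type*} [NormedAddCommGroup F'] [NormedSpace ℝ F']
    {H' : Type*} [TopologicalSpace H'] {J' : ModelWithCorners ℝ F' H'}
    {N' : Type*} [TopologicalSpace N'] [ChartedSpace H' N'] [J'.Boundaryless] [IsManifold J' ∞ N']
    {φ : N' → N} (a : RoughOneForm J N) {q : N} {q' : N'} {y : F'} {f : F' → F}
    (hy : y ∈ (extChartAt J' q').target) (hfy : f y ∈ (extChartAt J q).target)
    (hf : DifferentiableAt ℝ f y)
    (hφ : MDifferentiableAt J' J φ ((extChartAt J' q').symm y))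
    (h : φ ∘ (extChartAt J' q').symm =ᶠ[𝓝 y] (extChartAt J q).symm ∘ f) :
    chartForm (pullbackOneForm (J' := J') φ a) q' y =
      (chartForm a q (f y)).comp (fderiv ℝ f y) := by
  have h1 := mfderiv_comp y hφ (mdifferentiableAt_extChartAt_symm_of_mem q' hy)
  have h2 := mfderiv_comp y (mdifferentiableAt_extChartAt_symm_of_mem q hfy)
    hf.mdifferentiableAt
  rw [h.mfderiv_eq, h2, mfderiv_eq_fderiv] at h1
  have h0 : φ ((extChartAt J' q').symm y) = (extChartAt J q).symm (f y) := h.eq_of_nhds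
  ext v
  have h3 := DFunLike.congr_fun h1 v
  change (a (φ ((extChartAt J' q').symm y)) (mfderiv J' J φ ((extChartAt J' q').symm y)
    (mfderiv 𝓘(ℝ, F') J' (extChartAt J' q').symm y v)) : ℝ) =
      a ((extChartAt J q).symm (f y)) (mfderiv 𝓘(ℝ, F) J (extChartAt J q).symm (f y)
        (fderiv ℝ f y v))
  have h4 : ∀ (r : N) (w : F), φ ((extChartAt J' q').symm y) = r →
      (a (φ ((extChartAt J' q').symm y)) w : ℝ) = a r w := by
    rintro _ w rfl; rfl
  exact (congrArg (a (φ ((extChartAt J' q').symm y))) h3.symm).trans (h4 _ _ h0)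

/-- The expressions of a one-form in two charts are related by the change of coordinates. -/
theorem chartForm_change (a : RoughOneForm J N) {q r : N} {y : F}
    (hy : y ∈ (extChartAt J q).target) (hr : (extChartAt J q).symm y ∈ (extChartAt J r).source) :
    chartForm a q y = (chartForm a r (extChartAt J r ((extChartAt J q).symm y))).comp
      (fderiv ℝ (extChartAt J r ∘ (extChartAt J q).symm) y) := by
  have h := chartForm_pullback (φ := (id : N → N)) (J' := J) a (q := r) (q' := q)
    (f := extChartAt J r ∘ (extChartAt J q).symm) hy ((extChartAt J r).map_source hr)
    ((contDiffAt_extChartAt_comp_symm hy hr).differentiableAt (by simp)) mdifferentiableAt_id ?_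
  · have h2 : pullbackOneForm (J' := J) (id : N → N) a = a := by
      funext x; ext v; simp [pullbackOneForm]
    rwa [h2] at h
  · filter_upwards [(contMDiffAt_extChartAt_symm_of_mem q hy).continuousAt
      ((isOpen_extChartAt_source r).mem_nhds hr)] with z hz
    exact ((extChartAt J r).left_inv hz).symm

/-- The exterior derivative can be computed in any preferred chart. -/
theorem extDerivOneForm_eq {a : RoughOneForm J N} {q : N} {y : F}
    (hy : y ∈ (extChartAt J q).target)
    (ha : DifferentiableAt ℝ (chartForm a ((extChartAt J q).symm y))
      (extChartAt J ((extChartAt J q).symm y) ((extChartAt J q).symm y))) :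
    ∀ u v : TangentSpace J ((extChartAt J q).symm y),
      extDerivOneForm a ((extChartAt J q).symm y) u v = flatCurl (chartForm a q) y
        (mfderiv J 𝓘(ℝ, F) (extChartAt J q) ((extChartAt J q).symm y) u)
        (mfderiv J 𝓘(ℝ, F) (extChartAt J q) ((extChartAt J q).symm y) v) := by
  set r := (extChartAt J q).symm y with hr
  intro u v
  set D := mfderiv J 𝓘(ℝ, F) (extChartAt J q) r
  set f := extChartAt J r ∘ (extChartAt J q).symm with hf
  have hrs : (extChartAt J q).symm y ∈ (extChartAt J r).source := mem_extChartAt_source r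
  have hfc : ContDiffAt ℝ ∞ f y := contDiffAt_extChartAt_comp_symm hy hrs
  have he : chartForm a q =ᶠ[𝓝 y] fun z => (chartForm a r (f z)).comp (fderiv ℝ f z) := by
    filter_upwards [eventually_mem_extChartAt_target q hy,
      (contMDiffAt_extChartAt_symm_of_mem q hy).continuousAt
        ((isOpen_extChartAt_source r).mem_nhds hrs)] with z hz hz'
    exact chartForm_change a hz hz'
  -- `extDerivOneForm` uses the chart centred at `r` itself. The chain rule for the change of charts
  -- `f` carries the vectors over, and `flatCurl_pullback` carries the form.
  have hfd : ∀ w : TangentSpace J r, fderiv ℝ f y (D w) = mfderiv J 𝓘(ℝ, F) (extChartAt J r) r w := by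
    intro w
    have h1 := mfderiv_comp y (mdifferentiableAt_extChartAt_of_mem r hrs)
      (mdifferentiableAt_extChartAt_symm_of_mem q hy)
    rw [mfderiv_eq_fderiv] at h1
    have h2 := DFunLike.congr_fun h1 (D w)
    refine h2.trans ?_
    exact congrArg (mfderiv J 𝓘(ℝ, F) (extChartAt J r) r)
      (mfderiv_symm_mfderiv_extChartAt_apply q hy w)
  rw [Filter.EventuallyEq.flatCurl_eq he]
  have hf2 : ContDiffAt ℝ 2 f y := hfc.of_le ENat.LEInfty.out
  refine Eq.trans ?_ (flatCurl_pullback (f := f) ha hf2 (D u) (D v)).symm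
  refine Eq.trans ?_ (congrArg₂ (fun u' v' => flatCurl (chartForm a r) (f y) u' v')
    (hfd u) (hfd v)).symm
  rfl

/-- The expression in a chart of the differential of a function. -/
theorem chartForm_diffFun {f : N → ℝ} {q : N} {y : F} (hy : y ∈ (extChartAt J q).target)
    (hf : MDifferentiableAt J 𝓘(ℝ, ℝ) f ((extChartAt J q).symm y)) :
    chartForm (J := J) (diffFun f) q y = fderiv ℝ (f ∘ (extChartAt J q).symm) y := by
  have h1 := mfderiv_comp y hf (mdifferentiableAt_extChartAt_symm_of_mem q hy)
  rw [mfderiv_eq_fderiv] at h1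
  rw [h1]
  rfl

/-- A smooth one-form is closed if and only if its expressions in all charts are. -/
theorem isClosedOneForm_iff {a : RoughOneForm J N} (ha : IsSmoothOneForm a) :
    IsClosedOneForm a ↔ ∀ q, ∀ y ∈ (extChartAt J q).target, flatCurl (chartForm a q) y = 0 := by
  constructor
  · intro h q y hy
    ext u v
    have h1 := extDerivOneForm_eq hy ((ha.contDiffAt _ (mem_extChartAt_target _)).differentiableAt
      (by simp)) (mfderiv 𝓘(ℝ, F) J (extChartAt J q).symm y u)
      (mfderiv 𝓘(ℝ, F) J (extChartAt J q).symm y v)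
    rw [h, mfderiv_extChartAt_mfderiv_symm_apply q hy,
      mfderiv_extChartAt_mfderiv_symm_apply q hy] at h1
    exact h1.symm
  · intro h q
    have h1 := h q _ (mem_extChartAt_target q)
    ext u v
    change flatCurl (chartForm a q) (extChartAt J q q) _ _ = 0
    rw [h1]
    rfl

end FormsInCharts

/-! ### Cotangent charts and the canonical symplectic form -/

section CotangentCharts

variable {E : Type*} [NormedAddCommGroup E] [NormedSpace ℝ E]
  {M : Type*} [TopologicalSpace M] [ChartedSpace E M] [IsManifold 𝓘(ℝ, E) ∞ M]
  {G : Opens (CotangentBundle E M)}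

/-- A bundle chart of `T^*M` is defined over the whole preimage of the base chart, and restriction
to the open set `G` removes only points outside `G`. So membership is a condition on the base point
alone. -/
theorem mem_extChartAt_source_cotangent_iff (q r : G) :
    r ∈ (extChartAt (cotangentModel E) q).source ↔
      cotProj r ∈ (extChartAt 𝓘(ℝ, E) (cotProj q)).source := by
  rw [extChartAt_source, extChartAt_source, Opens.chartAt_eq, OpenPartialHomeomorph.subtypeRestr_source]
  change r.1 ∈ (chartAt (ModelProd E (E →L[ℝ] ℝ)) q.1).source ↔ r.1.proj ∈ _
  rw [FiberBundle.chartedSpace_chartAt]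
  simp only [cotProj, OpenPartialHomeomorph.trans_source]
  refine ⟨fun h => ?_, fun h => ?_⟩
  · simpa using h.1
  · exact ⟨by simpa using h, h, trivial⟩

theorem extChartAt_cotangent_apply (q r : G) :
    extChartAt (cotangentModel E) q r = (extChartAt 𝓘(ℝ, E) (cotProj q) (cotProj r),
      ((trivializationAt (E →L[ℝ] ℝ) (fun x : M => CotangentSpace 𝓘(ℝ, E) x) (cotProj q)) r.1).2) := by
  rfl

/-- The fibre coordinate of `(x, α x)` in a chart of the cotangent bundle is given by the
expression of `α` in the corresponding chart of the base. -/
theorem extChartAt_cotangent_mk (q : G) (α : RoughOneForm 𝓘(ℝ, E) M) {x : M}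
    (hx : x ∈ (extChartAt 𝓘(ℝ, E) (cotProj q)).source) (hG : Bundle.TotalSpace.mk x (α x) ∈ G) :
    extChartAt (cotangentModel E) q (⟨Bundle.TotalSpace.mk x (α x), hG⟩ : G) =
      (extChartAt 𝓘(ℝ, E) (cotProj q) x,
        chartForm α (cotProj q) (extChartAt 𝓘(ℝ, E) (cotProj q) x)) := by
  rw [extChartAt_cotangent_apply]
  exact Prod.ext rfl (inCoordinates_eq_chartForm α (cotProj q) hx)

theorem extChartAt_cotangent_fst {q : G} {w : E × (E →L[ℝ] ℝ)}
    (hw : w ∈ (extChartAt (cotangentModel E) q).target) :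
    w.1 = extChartAt 𝓘(ℝ, E) (cotProj q) (cotProj ((extChartAt (cotangentModel E) q).symm w)) := by
  conv_lhs => rw [← (extChartAt (cotangentModel E) q).right_inv hw]
  rfl

theorem fst_mem_target {q : G} {w : E × (E →L[ℝ] ℝ)}
    (hw : w ∈ (extChartAt (cotangentModel E) q).target) :
    w.1 ∈ (extChartAt 𝓘(ℝ, E) (cotProj q)).target := by
  rw [extChartAt_cotangent_fst hw]
  exact (extChartAt 𝓘(ℝ, E) (cotProj q)).map_source
    ((mem_extChartAt_source_cotangent_iff q _).1 ((extChartAt (cotangentModel E) q).map_target hw))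

theorem cotProj_extChartAt_symm {q : G} {w : E × (E →L[ℝ] ℝ)}
    (hw : w ∈ (extChartAt (cotangentModel E) q).target) :
    cotProj ((extChartAt (cotangentModel E) q).symm w) =
      (extChartAt 𝓘(ℝ, E) (cotProj q)).symm w.1 := by
  conv_rhs => rw [extChartAt_cotangent_fst hw]
  exact ((extChartAt 𝓘(ℝ, E) (cotProj q)).left_inv ((mem_extChartAt_source_cotangent_iff q _).1
    ((extChartAt (cotangentModel E) q).map_target hw))).symm

theorem graph_extChartAt (ζ : ClosedFormIn G) (q : G) {y : E}
    (hy : y ∈ (extChartAt 𝓘(ℝ, E) (cotProj q)).target) :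
    extChartAt (cotangentModel E) q (ζ.toSection ((extChartAt 𝓘(ℝ, E) (cotProj q)).symm y)) =
      (y, chartForm ζ.form (cotProj q) y) := by
  have h := extChartAt_cotangent_mk q ζ.form ((extChartAt 𝓘(ℝ, E) (cotProj q)).map_target hy)
    (ζ.graph_mem _)
  rwa [(extChartAt 𝓘(ℝ, E) (cotProj q)).right_inv hy] at h

theorem toSection_mem_source (ζ : ClosedFormIn G) (q : G) {y : E}
    (hy : y ∈ (extChartAt 𝓘(ℝ, E) (cotProj q)).target) :
    ζ.toSection ((extChartAt 𝓘(ℝ, E) (cotProj q)).symm y) ∈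
      (extChartAt (cotangentModel E) q).source :=
  (mem_extChartAt_source_cotangent_iff q _).2 ((extChartAt 𝓘(ℝ, E) (cotProj q)).map_target hy)

theorem graph_mem_target (ζ : ClosedFormIn G) (q : G) {y : E}
    (hy : y ∈ (extChartAt 𝓘(ℝ, E) (cotProj q)).target) :
    (y, chartForm ζ.form (cotProj q) y) ∈ (extChartAt (cotangentModel E) q).target := by
  rw [← graph_extChartAt ζ q hy]
  exact (extChartAt (cotangentModel E) q).map_source (toSection_mem_source ζ q hy)

theorem extChartAt_symm_graph (ζ : ClosedFormIn G) (q : G) {y : E}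
    (hy : y ∈ (extChartAt 𝓘(ℝ, E) (cotProj q)).target) :
    (extChartAt (cotangentModel E) q).symm (y, chartForm ζ.form (cotProj q) y) =
      ζ.toSection ((extChartAt 𝓘(ℝ, E) (cotProj q)).symm y) := by
  rw [← graph_extChartAt ζ q hy]
  exact (extChartAt (cotangentModel E) q).left_inv (toSection_mem_source ζ q hy)

theorem contMDiff_cotProj : ContMDiff (cotangentModel E) 𝓘(ℝ, E) ∞ (cotProj : G → M) :=
  (Bundle.contMDiff_proj _).comp contMDiff_subtype_val

theorem ClosedFormIn.contMDiff_toSection (ζ : ClosedFormIn G) :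
    ContMDiff 𝓘(ℝ, E) (cotangentModel E) ∞ ζ.toSection :=
  (ContMDiff.subtypeVal_comp_iff G ζ.toSection).1 ζ.smooth

theorem chartForm_pullback_cotProj (α : RoughOneForm 𝓘(ℝ, E) M) {q : G} {w : E × (E →L[ℝ] ℝ)}
    (hw : w ∈ (extChartAt (cotangentModel E) q).target) :
    chartForm (pullbackOneForm (J' := cotangentModel E) (cotProj : G → M) α) q w =
      (chartForm α (cotProj q) w.1).comp (ContinuousLinearMap.fst ℝ E (E →L[ℝ] ℝ)) := by
  rw [chartForm_pullback α (f := Prod.fst) (q := cotProj q) hw (fst_mem_target hw)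
    differentiableAt_fst (contMDiff_cotProj.mdifferentiableAt (by simp)), fderiv_fst]
  filter_upwards [eventually_mem_extChartAt_target q hw] with z hz
  exact cotProj_extChartAt_symm hz

theorem ClosedFormIn.contDiffAt (ζ : ClosedFormIn G) (x : M) {y : E}
    (hy : y ∈ (extChartAt 𝓘(ℝ, E) x).target) : ContDiffAt ℝ ∞ (chartForm ζ.form x) y :=
  ζ.smooth.contDiffAt x hy

theorem chartForm_pullback_toSection (ζ : ClosedFormIn G) (g : FormOn G) {q : G} {y : E}
    (hy : y ∈ (extChartAt 𝓘(ℝ, E) (cotProj q)).target) :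
    chartForm (pullbackOneForm (J' := 𝓘(ℝ, E)) ζ.toSection g) (cotProj q) y =
      (chartForm g q (y, chartForm ζ.form (cotProj q) y)).comp
        ((ContinuousLinearMap.id ℝ E).prod (fderiv ℝ (chartForm ζ.form (cotProj q)) y)) := by
  have hd : DifferentiableAt ℝ (chartForm ζ.form (cotProj q)) y :=
    (ζ.contDiffAt _ hy).differentiableAt (by simp)
  have hf : HasFDerivAt (fun y => (y, chartForm ζ.form (cotProj q) y)) _ y :=
    (hasFDerivAt_id y).prodMk hd.hasFDerivAt
  rw [chartForm_pullback g (f := fun y => (y, chartForm ζ.form (cotProj q) y)) (q := q) hy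
    (graph_mem_target ζ q hy) hf.differentiableAt
    (ζ.contMDiff_toSection.mdifferentiableAt (by simp)), hf.fderiv]
  filter_upwards [eventually_mem_extChartAt_target _ hy] with z hz
  exact (extChartAt_symm_graph ζ q hz).symm

variable (E) in
/-- The tautological one-form on `E × E^*`. -/
def flatTaut : (E × (E →L[ℝ] ℝ)) →L[ℝ] (E × (E →L[ℝ] ℝ)) →L[ℝ] ℝ :=
  ((ContinuousLinearMap.compL ℝ (E × (E →L[ℝ] ℝ)) E ℝ).flip
    (ContinuousLinearMap.fst ℝ E (E →L[ℝ] ℝ))).comp (ContinuousLinearMap.snd ℝ E (E →L[ℝ] ℝ))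

theorem flatTaut_apply (u v : E × (E →L[ℝ] ℝ)) : flatTaut E u v = u.2 v.1 := rfl

variable (E) in
/-- The canonical symplectic form on `E × E^*`. -/
def flatOmega : (E × (E →L[ℝ] ℝ)) →L[ℝ] (E × (E →L[ℝ] ℝ)) →L[ℝ] ℝ :=
  flatCurl (flatTaut E) 0

theorem flatCurl_flatTaut (w : E × (E →L[ℝ] ℝ)) : flatCurl (flatTaut E) w = flatOmega E := by
  refine ContinuousLinearMap.ext fun u => ContinuousLinearMap.ext fun v => ?_
  rw [flatOmega, flatCurl_apply, flatCurl_apply, ContinuousLinearMap.fderiv,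
    ContinuousLinearMap.fderiv]

theorem flatOmega_apply (u v : E × (E →L[ℝ] ℝ)) : flatOmega E u v = u.2 v.1 - v.2 u.1 := by
  rw [flatOmega, flatCurl_apply, ContinuousLinearMap.fderiv, flatTaut_apply, flatTaut_apply]

theorem flatOmega_nondegenerate {u : E × (E →L[ℝ] ℝ)} (hu : ∀ v, flatOmega E u v = 0) :
    u = 0 := by
  have h (v : E × (E →L[ℝ] ℝ)) : u.2 v.1 - v.2 u.1 = 0 := by rw [← flatOmega_apply, hu]
  refine Prod.ext ?_ ?_
  · refine SeparatingDual.eq_zero_of_forall_dual_eq_zero (R := ℝ) fun p => ?_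
    simpa using h (0, p)
  · ext v
    simpa using h (v, 0)

/-- At a single covector `r` the tautological form coincides with `τ^* α` for every one-form `α` on
`M` whose value at the base point is `r`. The claim then follows from the chart expression of `τ^*
α`. -/
theorem chartForm_tautologicalForm {q : G} {w : E × (E →L[ℝ] ℝ)}
    (hw : w ∈ (extChartAt (cotangentModel E) q).target) :
    chartForm tautologicalForm q w = flatTaut E w := by
  classical
  set r := (extChartAt (cotangentModel E) q).symm w with hr
  have hrs : r ∈ (extChartAt (cotangentModel E) q).source :=
    (extChartAt (cotangentModel E) q).map_target hw
  -- Only the value at one point is used, so `α` need not be continuous.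
  let α : RoughOneForm 𝓘(ℝ, E) M := Function.update 0 (cotProj r) r.1.2
  have hα : α (cotProj r) = r.1.2 := Function.update_self ..
  have h1 : chartForm tautologicalForm q w =
      chartForm (pullbackOneForm (J' := cotangentModel E) (cotProj : G → M) α) q w := by
    change (tautologicalForm r).comp _ = ((α (cotProj r)).comp _).comp _
    rw [hα]
    rfl
  have h2 : w = (w.1, chartForm α (cotProj q) w.1) := by
    have hmem : Bundle.TotalSpace.mk (cotProj r) (α (cotProj r)) ∈ G := by
      rw [hα]; exact r.2
    have h3 := extChartAt_cotangent_mk q α ((mem_extChartAt_source_cotangent_iff q r).1 hrs) hmem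
    have h4 : (⟨Bundle.TotalSpace.mk (cotProj r) (α (cotProj r)), hmem⟩ : G) = r := by
      apply Subtype.ext
      change Bundle.TotalSpace.mk (cotProj r) (α (cotProj r)) = Bundle.TotalSpace.mk r.1.1 r.1.2
      rw [hα]
      rfl
    rw [h4, ← extChartAt_cotangent_fst hw, (extChartAt (cotangentModel E) q).right_inv hw] at h3
    exact h3
  rw [h1, chartForm_pullback_cotProj α hw]
  conv_rhs => rw [h2]
  rfl

theorem flatCurl_chartForm_tautologicalForm {q : G} {w : E × (E →L[ℝ] ℝ)}
    (hw : w ∈ (extChartAt (cotangentModel E) q).target) :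
    flatCurl (chartForm tautologicalForm q) w = flatOmega E := by
  have h : chartForm tautologicalForm q =ᶠ[𝓝 w] flatTaut E := by
    filter_upwards [eventually_mem_extChartAt_target q hw] with z hz
    exact chartForm_tautologicalForm hz
  rw [Filter.EventuallyEq.flatCurl_eq h, flatCurl_flatTaut]

/-- The canonical symplectic form in a chart. -/
theorem canonicalSymplectic_eq {q : G} {w : E × (E →L[ℝ] ℝ)}
    (hw : w ∈ (extChartAt (cotangentModel E) q).target)
    (u v : TangentSpace (cotangentModel E) ((extChartAt (cotangentModel E) q).symm w)) :
    canonicalSymplectic ((extChartAt (cotangentModel E) q).symm w) u v =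
      flatOmega E
        (mfderiv (cotangentModel E) 𝓘(ℝ, E × (E →L[ℝ] ℝ)) (extChartAt (cotangentModel E) q)
          ((extChartAt (cotangentModel E) q).symm w) u)
        (mfderiv (cotangentModel E) 𝓘(ℝ, E × (E →L[ℝ] ℝ)) (extChartAt (cotangentModel E) q)
          ((extChartAt (cotangentModel E) q).symm w) v) := by
  have hd : DifferentiableAt ℝ
      (chartForm tautologicalForm ((extChartAt (cotangentModel E) q).symm w))
      (extChartAt (cotangentModel E) ((extChartAt (cotangentModel E) q).symm w)
        ((extChartAt (cotangentModel E) q).symm w)) := by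
    refine (flatTaut E).differentiableAt.congr_of_eventuallyEq ?_
    filter_upwards [eventually_mem_extChartAt_target _ (mem_extChartAt_target
      (I := cotangentModel E) ((extChartAt (cotangentModel E) q).symm w))] with z hz
    exact chartForm_tautologicalForm hz
  refine (extDerivOneForm_eq hw hd u v).trans ?_
  rw [flatCurl_chartForm_tautologicalForm hw]

end CotangentCharts

/-! ### Forms and vector fields for a constant symplectic form -/

section FlatSymplectic

open VectorField

variable {V : Type*} [NormedAddCommGroup V] [NormedSpace ℝ V]

/-- Injectivity suffices because `V` and its dual have equal finite dimension. Invertibility is what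
makes `ContinuousLinearMap.inverse` a true inverse instead of its default value zero. -/
theorem isInvertible_of_nondegenerate [FiniteDimensional ℝ V] (B : V →L[ℝ] V →L[ℝ] ℝ)
    (h : ∀ u, (∀ v, B u v = 0) → u = 0) : B.IsInvertible := by
  have hinj : Function.Injective (B : V →ₗ[ℝ] V →L[ℝ] ℝ) :=
    (injective_iff_map_eq_zero _).2 fun u hu => h u fun v => by
      have : B u = 0 := hu
      rw [this]; rfl
  have hdim : Module.finrank ℝ V = Module.finrank ℝ (V →L[ℝ] ℝ) := by
    rw [← Subspace.dual_finrank_eq (K := ℝ) (V := V)]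
    exact (LinearMap.toContinuousLinearMap (𝕜 := ℝ) (E := V) (F' := ℝ)).finrank_eq
  refine ⟨(LinearEquiv.ofInjectiveOfFinrankEq _ hinj hdim).toContinuousLinearEquiv, ?_⟩
  ext u v
  rfl

variable {B : V →L[ℝ] V →L[ℝ] ℝ}

theorem hasFDerivAt_neg_flat {X : V → V} {w : V} (hX : DifferentiableAt ℝ X w) :
    HasFDerivAt (fun z => -B (X z)) (-(B.comp (fderiv ℝ X w))) w :=
  (B.hasFDerivAt.comp w hX.hasFDerivAt).neg

theorem flatCurl_neg_flat {X : V → V} {w : V} (hX : DifferentiableAt ℝ X w) (u v : V) :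
    flatCurl (fun z => -B (X z)) w u v = -B (fderiv ℝ X w u) v + B (fderiv ℝ X w v) u := by
  rw [flatCurl_apply, (hasFDerivAt_neg_flat hX).fderiv]
  simp

theorem fderiv_flat_apply {X Y : V → V} {w : V} (hX : DifferentiableAt ℝ X w)
    (hY : DifferentiableAt ℝ Y w) (v : V) :
    fderiv ℝ (fun z => B (X z) (Y z)) w v = B (fderiv ℝ X w v) (Y w) + B (X w) (fderiv ℝ Y w v) := by
  have h := (B.hasFDerivAt.comp w hX.hasFDerivAt).clm_apply hY.hasFDerivAt
  change fderiv ℝ (fun z => (B ∘ X) z (Y z)) w v = _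
  rw [h.fderiv]
  simp [add_comm]

theorem differentiableAt_flat_apply {X Y : V → V} {w : V} (hX : DifferentiableAt ℝ X w)
    (hY : DifferentiableAt ℝ Y w) : DifferentiableAt ℝ (fun z => B (X z) (Y z)) w :=
  ((B.hasFDerivAt.comp w hX.hasFDerivAt).clm_apply hY.hasFDerivAt).differentiableAt

/-- The bracket of one-forms corresponds to the bracket of vector fields. -/
theorem flat_formBracket (hB : ∀ u v, B u v = -B v u) {X Y : V → V} {w : V}
    (hX : DifferentiableAt ℝ X w) (hY : DifferentiableAt ℝ Y w) (v : V) :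
    fderiv ℝ (fun z => (-B (Y z)) (X z)) w v + flatCurl (fun z => -B (Y z)) w (X w) v
      - (fderiv ℝ (fun z => (-B (X z)) (Y z)) w v + flatCurl (fun z => -B (X z)) w (Y w) v)
      - fderiv ℝ (fun z => B (X z) (Y z)) w v = -B (lieBracket ℝ X Y w) v := by
  have h1 : (fun z => (-B (Y z)) (X z)) = fun z => B (X z) (Y z) := by
    funext z; rw [hB (X z)]; rfl
  have h2 : (fun z => (-B (X z)) (Y z)) = fun z => -(B (X z) (Y z)) := rfl
  rw [h1, h2, fderiv_fun_neg, flatCurl_neg_flat hX, flatCurl_neg_flat hY,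
    neg_apply, fderiv_flat_apply hX hY, lieBracket_eq]
  simp only [map_sub, sub_apply]
  rw [hB (X w), hB (fderiv ℝ X w v)]
  ring

/-- The bracket of two symplectic vector fields is symplectic. -/
theorem flatCurl_lieBracket_eq_zero (hB : ∀ u v, B u v = -B v u) {X Y : V → V} {w : V}
    (hX : ContDiffAt ℝ ∞ X w) (hY : ContDiffAt ℝ ∞ Y w)
    (hXc : ∀ᶠ z in 𝓝 w, flatCurl (fun z => -B (X z)) z = 0)
    (hYc : ∀ᶠ z in 𝓝 w, flatCurl (fun z => -B (Y z)) z = 0) :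
    flatCurl (fun z => -B (lieBracket ℝ X Y z)) w = 0 := by
  -- The bracket of two symplectic fields is Hamiltonian, with Hamiltonian `B (X, Y)`. The form is
  -- thus locally exact, and closedness is the symmetry of the second derivative.
  have he : (fun z => -B (lieBracket ℝ X Y z)) =ᶠ[𝓝 w]
      fderiv ℝ (fun z => B (X z) (Y z)) := by
    filter_upwards [(hX.of_le (m := 1) ENat.LEInfty.out).eventually (by simp),
      (hY.of_le (m := 1) ENat.LEInfty.out).eventually (by simp), hXc, hYc]
      with z hXz hYz hXcz hYcz
    ext v
    have hXd : DifferentiableAt ℝ X z := hXz.differentiableAt (by simp)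
    have hYd : DifferentiableAt ℝ Y z := hYz.differentiableAt (by simp)
    have h1 := flatCurl_neg_flat (B := B) hXd (Y z) v
    have h2 := flatCurl_neg_flat (B := B) hYd (X z) v
    rw [hXcz] at h1
    rw [hYcz] at h2
    simp only [zero_apply] at h1 h2
    rw [fderiv_flat_apply hXd hYd, lieBracket_eq]
    simp only [map_sub, neg_apply, sub_apply]
    rw [hB (X z)]
    linarith
  rw [Filter.EventuallyEq.flatCurl_eq he]
  have hs : ContDiffAt ℝ ∞ (fun z => B (X z) (Y z)) w :=
    (B.contDiff.contDiffAt.comp w hX).clm_apply hY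
  have hsymm := hs.isSymmSndFDerivAt (by simpa using ENat.LEInfty.out)
  refine ContinuousLinearMap.ext fun u => ContinuousLinearMap.ext fun v => ?_
  rw [flatCurl_apply]
  exact sub_eq_zero.2 (hsymm.eq u v)

/-- The vector field `X` with `B (X, ·) = -A`. -/
def hamField (B : V →L[ℝ] V →L[ℝ] ℝ) (A : V → V →L[ℝ] ℝ) (w : V) : V := -B.inverse (A w)

theorem neg_flat_hamField (hB : B.IsInvertible) (A : V → V →L[ℝ] ℝ) (w : V) :
    -B (hamField B A w) = A w := by
  rw [hamField, map_neg, neg_neg, hB.self_apply_inverse]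

theorem hamField_eq_of_forall (hB : B.IsInvertible) {A : V → V →L[ℝ] ℝ} {w Z : V}
    (h : ∀ v, A w v = -B Z v) : hamField B A w = Z := by
  have h1 : B (hamField B A w) = B Z := by
    refine ContinuousLinearMap.ext fun v => ?_
    have h2 := h v
    rw [← neg_flat_hamField hB A] at h2
    exact neg_injective h2
  exact hB.injective h1

theorem contDiffOn_hamField_iff (hB : B.IsInvertible) {A : V → V →L[ℝ] ℝ} {s : Set V} :
    ContDiffOn ℝ ∞ (hamField B A) s ↔ ContDiffOn ℝ ∞ A s := by
  refine ⟨fun h => ?_, fun h => (B.inverse.contDiff.comp_contDiffOn h).neg⟩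
  exact (B.contDiff.comp_contDiffOn h).neg.congr fun w _ => (neg_flat_hamField hB A w).symm

end FlatSymplectic

/-! ### The vector field of a one-form in a chart -/

section ChartFields

open VectorField

variable {E : Type*} [NormedAddCommGroup E] [NormedSpace ℝ E]
  {M : Type*} [TopologicalSpace M] [ChartedSpace E M] [IsManifold 𝓘(ℝ, E) ∞ M]
  {G : Opens (CotangentBundle E M)}

theorem flatOmega_antisymm (u v : E × (E →L[ℝ] ℝ)) : flatOmega E u v = -flatOmega E v u := by
  rw [flatOmega_apply, flatOmega_apply, neg_sub]

/-- The expression in a chart of the vector field generated by a one-form. -/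
def chartField (a : FormOn G) (q : G) : E × (E →L[ℝ] ℝ) → E × (E →L[ℝ] ℝ) :=
  hamField (flatOmega E) (chartForm a q)

variable [FiniteDimensional ℝ E]

variable (E) in
theorem flatOmega_isInvertible : (flatOmega E).IsInvertible :=
  isInvertible_of_nondegenerate _ fun _ => flatOmega_nondegenerate

theorem neg_flatOmega_chartField (a : FormOn G) (q : G) (w : E × (E →L[ℝ] ℝ)) :
    -flatOmega E (chartField a q w) = chartForm a q w :=
  neg_flat_hamField (flatOmega_isInvertible E) _ _

theorem chartForm_apply_eq (a : FormOn G) (q : G) (w v : E × (E →L[ℝ] ℝ)) :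
    chartForm a q w v = -flatOmega E (chartField a q w) v := by
  rw [← neg_flatOmega_chartField]
  rfl

theorem chartField_eq_of_forall {a : FormOn G} {q : G} {w Z : E × (E →L[ℝ] ℝ)}
    (h : ∀ v, chartForm a q w v = -flatOmega E Z v) : chartField a q w = Z :=
  hamField_eq_of_forall (flatOmega_isInvertible E) h

theorem chartField_inj {a b : FormOn G} {q : G} {w : E × (E →L[ℝ] ℝ)}
    (h : chartField a q w = chartField b q w) : chartForm a q w = chartForm b q w := by
  rw [← neg_flatOmega_chartField, h, neg_flatOmega_chartField]

theorem chartField_add (a b : FormOn G) (q : G) (w : E × (E →L[ℝ] ℝ)) :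
    chartField (a + b) q w = chartField a q w + chartField b q w := by
  refine chartField_eq_of_forall fun v => ?_
  have h : chartForm (a + b) q w v = chartForm a q w v + chartForm b q w v := rfl
  rw [h, chartForm_apply_eq, chartForm_apply_eq, flatOmega_apply, flatOmega_apply,
    flatOmega_apply]
  simp only [Prod.fst_add, Prod.snd_add, add_apply, map_add]
  ring

theorem chartField_smul (c : ℝ) (a : FormOn G) (q : G) (w : E × (E →L[ℝ] ℝ)) :
    chartField (c • a) q w = c • chartField a q w := by
  refine chartField_eq_of_forall fun v => ?_
  have h : chartForm (c • a) q w v = c * chartForm a q w v := rfl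
  rw [h, chartForm_apply_eq, flatOmega_apply, flatOmega_apply]
  simp only [Prod.smul_fst, Prod.smul_snd, smul_apply, map_smul, smul_eq_mul]
  ring

theorem formOn_ext {a b : FormOn G}
    (h : ∀ q, ∀ w ∈ (extChartAt (cotangentModel E) q).target, chartField a q w = chartField b q w) :
    a = b :=
  roughOneForm_ext fun q w hw => chartField_inj (h q w hw)

theorem isSmoothOneForm_iff_chartField {a : FormOn G} : IsSmoothOneForm a ↔
    ∀ q, ContDiffOn ℝ ∞ (chartField a q) (extChartAt (cotangentModel E) q).target := by
  rw [isSmoothOneForm_iff]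
  exact forall_congr' fun q => (contDiffOn_hamField_iff (flatOmega_isInvertible E)).symm

theorem IsSmoothOneForm.contDiffAt_chartField {a : FormOn G} (ha : IsSmoothOneForm a) (q : G)
    {w : E × (E →L[ℝ] ℝ)} (hw : w ∈ (extChartAt (cotangentModel E) q).target) :
    ContDiffAt ℝ ∞ (chartField a q) w :=
  (isSmoothOneForm_iff_chartField.1 ha q).contDiffAt ((isOpen_extChartAt_target q).mem_nhds hw)

/-- The vector field generated by a one-form is computed in a chart by `chartField`. -/
theorem mfderiv_symplecticField (a : FormOn G) {q : G} {w : E × (E →L[ℝ] ℝ)}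
    (hw : w ∈ (extChartAt (cotangentModel E) q).target) :
    mfderiv (cotangentModel E) 𝓘(ℝ, E × (E →L[ℝ] ℝ)) (extChartAt (cotangentModel E) q)
      ((extChartAt (cotangentModel E) q).symm w)
      (symplecticField a ((extChartAt (cotangentModel E) q).symm w)) = chartField a q w := by
  set r := (extChartAt (cotangentModel E) q).symm w with hr
  set D := mfderiv (cotangentModel E) 𝓘(ℝ, E × (E →L[ℝ] ℝ)) (extChartAt (cotangentModel E) q) r
  set D' := mfderiv 𝓘(ℝ, E × (E →L[ℝ] ℝ)) (cotangentModel E) (extChartAt (cotangentModel E) q).symm w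
  have hDD' (v : E × (E →L[ℝ] ℝ)) : D (D' v) = v := mfderiv_extChartAt_mfderiv_symm_apply q hw v
  have hD'D (v : TangentSpace (cotangentModel E) r) : D' (D v) = v :=
    mfderiv_symm_mfderiv_extChartAt_apply q hw v
  -- Non-degeneracy is inherited from the chart through the mutually inverse derivatives `D` and
  -- `D'`.
  have hinv : (canonicalSymplectic r).IsInvertible := by
    refine isInvertible_of_nondegenerate (V := E × (E →L[ℝ] ℝ)) (canonicalSymplectic r)
      fun u hu => ?_
    have h1 : D u = 0 := by
      refine flatOmega_nondegenerate fun v => ?_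
      have h2 := hu (D' v)
      rw [← hDD' v]
      exact (canonicalSymplectic_eq hw u (D' v)).symm.trans h2
    have h3 := hD'D u
    rw [h1] at h3
    exact h3.symm.trans (map_zero D')
  have h4 : canonicalSymplectic r (D' (chartField a q w)) = -(a r) := by
    refine ContinuousLinearMap.ext fun v => ?_
    refine (canonicalSymplectic_eq hw (D' (chartField a q w)) v).trans ?_
    have h5 : flatOmega E (D (D' (chartField a q w))) (D v) =
        flatOmega E (chartField a q w) (D v) := by rw [hDD']
    refine h5.trans ?_
    have h6 := apply_eq_chartForm a q hw v
    exact (neg_eq_iff_eq_neg.2 (h6.trans (chartForm_apply_eq a q w (D v)))).symm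
  have h7 : symplecticField a r = D' (chartField a q w) := (hinv.inverse_apply_eq).2 h4.symm
  rw [h7]
  exact hDD' _

end ChartFields

/-! ### The bracket and the operation `τ^* ζ^*` in charts -/

section BracketInCharts

open VectorField

variable {E : Type*} [NormedAddCommGroup E] [NormedSpace ℝ E]
  {M : Type*} [TopologicalSpace M] [ChartedSpace E M] [IsManifold 𝓘(ℝ, E) ∞ M]
  {G : Opens (CotangentBundle E M)}

/-- The vector field obtained from `X` by projection along the graph of `z` to the fibres of
`E × P → E`, extended to a constant field on each fibre. -/
def graphProj {E P : Type*} [NormedAddCommGroup E] [NormedSpace ℝ E] [NormedAddCommGroup P]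
    [NormedSpace ℝ P] (z : E → P) (X : E × P → E × P) (w : E × P) : E × P :=
  (0, (X (w.1, z w.1)).2 - fderiv ℝ z w.1 (X (w.1, z w.1)).1)

/-- The operation `g ↦ τ^* ζ^* g`. -/
def basicPart (ζ : ClosedFormIn G) (g : FormOn G) : FormOn G :=
  pullbackOneForm cotProj (pullbackOneForm (J' := 𝓘(ℝ, E)) ζ.toSection g)

theorem etaOp_apply (f g : FormFamily G) (ζ : ClosedFormIn G) :
    etaOp f g ζ = formBracket (f ζ) (basicPart ζ (g ζ)) := rfl

theorem ClosedFormIn.fderiv_symm (ζ : ClosedFormIn G) (x : M) {y : E}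
    (hy : y ∈ (extChartAt 𝓘(ℝ, E) x).target) (u v : E) :
    fderiv ℝ (chartForm ζ.form x) y u v = fderiv ℝ (chartForm ζ.form x) y v u := by
  have h := (isClosedOneForm_iff ζ.smooth).1 ζ.closed x y hy
  have h1 := flatCurl_apply (chartForm ζ.form x) y u v
  rw [h] at h1
  exact (sub_eq_zero.1 h1.symm)

variable [FiniteDimensional ℝ E]

theorem chartForm_eq_neg_flatOmega (a : FormOn G) (q : G) :
    chartForm a q = fun z => -flatOmega E (chartField a q z) :=
  funext fun z => (neg_flatOmega_chartField a q z).symm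

theorem chartForm_lieDerivOneForm {a b : FormOn G} (ha : IsSmoothOneForm a)
    (hb : IsSmoothOneForm b) {q : G} {w : E × (E →L[ℝ] ℝ)}
    (hw : w ∈ (extChartAt (cotangentModel E) q).target) (v : E × (E →L[ℝ] ℝ)) :
    chartForm (lieDerivOneForm (symplecticField a) b) q w v =
      fderiv ℝ (fun z => chartForm b q z (chartField a q z)) w v +
        flatCurl (chartForm b q) w (chartField a q w) v := by
  set r := (extChartAt (cotangentModel E) q).symm w with hr
  set D' := mfderiv 𝓘(ℝ, E × (E →L[ℝ] ℝ)) (cotangentModel E) (extChartAt (cotangentModel E) q).symm w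
  have he : (fun r => (b r (symplecticField a r) : ℝ)) ∘ (extChartAt (cotangentModel E) q).symm
      =ᶠ[𝓝 w] fun z => chartForm b q z (chartField a q z) := by
    filter_upwards [eventually_mem_extChartAt_target q hw] with z hz
    refine (apply_eq_chartForm b q hz _).trans ?_
    rw [← mfderiv_symplecticField a hz]
  have hd : DifferentiableAt ℝ (fun z => chartForm b q z (chartField a q z)) w :=
    ((hb.contDiffAt q hw).differentiableAt (by simp)).clm_apply
      ((ha.contDiffAt_chartField q hw).differentiableAt (by simp))
  have h1 : chartForm (J := cotangentModel E)
      (diffFun fun r => (b r (symplecticField a r) : ℝ)) q w v =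
        fderiv ℝ (fun z => chartForm b q z (chartField a q z)) w v := by
    rw [chartForm_diffFun hw
      (mdifferentiableAt_of_comp_symm hw (hd.congr_of_eventuallyEq he)), he.fderiv_eq]
  have h2 : (extDerivOneForm b r (symplecticField a r) (D' v) : ℝ) =
      flatCurl (chartForm b q) w (chartField a q w) v := by
    refine (extDerivOneForm_eq hw ((hb.contDiffAt _ (mem_extChartAt_target _)).differentiableAt
      (by simp)) (symplecticField a r) (D' v)).trans ?_
    rw [← mfderiv_symplecticField a hw]
    exact congrArg (flatCurl (chartForm b q) w _) (mfderiv_extChartAt_mfderiv_symm_apply q hw v)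
  rw [← h1, ← h2]
  rfl

/-- The bracket of one-forms is computed in a chart by the bracket of vector fields. -/
theorem chartField_formBracket {a b : FormOn G} (ha : IsSmoothOneForm a)
    (hb : IsSmoothOneForm b) {q : G} {w : E × (E →L[ℝ] ℝ)}
    (hw : w ∈ (extChartAt (cotangentModel E) q).target) :
    chartField (formBracket a b) q w = lieBracket ℝ (chartField a q) (chartField b q) w := by
  refine chartField_eq_of_forall fun v => ?_
  have hX : DifferentiableAt ℝ (chartField a q) w :=
    (ha.contDiffAt_chartField q hw).differentiableAt (by simp)
  have hY : DifferentiableAt ℝ (chartField b q) w :=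
    (hb.contDiffAt_chartField q hw).differentiableAt (by simp)
  have he : (fun r => (canonicalSymplectic r (symplecticField a r) (symplecticField b r) : ℝ)) ∘
      (extChartAt (cotangentModel E) q).symm
      =ᶠ[𝓝 w] fun z => flatOmega E (chartField a q z) (chartField b q z) := by
    filter_upwards [eventually_mem_extChartAt_target q hw] with z hz
    refine (canonicalSymplectic_eq hz _ _).trans ?_
    rw [← mfderiv_symplecticField a hz, ← mfderiv_symplecticField b hz]
  have hd : DifferentiableAt ℝ (fun z => flatOmega E (chartField a q z) (chartField b q z)) w :=
    differentiableAt_flat_apply hX hY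
  have h1 : chartForm (J := cotangentModel E) (diffFun fun r =>
      (canonicalSymplectic r (symplecticField a r) (symplecticField b r) : ℝ)) q w v =
        fderiv ℝ (fun z => flatOmega E (chartField a q z) (chartField b q z)) w v := by
    rw [chartForm_diffFun hw
      (mdifferentiableAt_of_comp_symm hw (hd.congr_of_eventuallyEq he)), he.fderiv_eq]
  have h2 : chartForm (formBracket a b) q w v =
      chartForm (lieDerivOneForm (symplecticField a) b) q w v -
        chartForm (lieDerivOneForm (symplecticField b) a) q w v -
        chartForm (J := cotangentModel E) (diffFun fun r =>
          (canonicalSymplectic r (symplecticField a r) (symplecticField b r) : ℝ)) q w v := rfl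
  rw [h2, h1, chartForm_lieDerivOneForm ha hb hw, chartForm_lieDerivOneForm hb ha hw,
    chartForm_eq_neg_flatOmega a, chartForm_eq_neg_flatOmega b]
  exact flat_formBracket flatOmega_antisymm hX hY v

/-- With `X` the field of `g` and `z` the expression of `ζ`, the pull-back to the graph sends `v` to
`-(X.2 v - (Dz v) X.1)`. Closedness of `ζ` makes `Dz` symmetric, which turns the last term into `(Dz
X.1) v`, and the vertical field of `graphProj` appears. -/
theorem chartField_basicPart (ζ : ClosedFormIn G) (g : FormOn G) {q : G} {w : E × (E →L[ℝ] ℝ)}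
    (hw : w ∈ (extChartAt (cotangentModel E) q).target) :
    chartField (basicPart ζ g) q w =
      graphProj (chartForm ζ.form (cotProj q)) (chartField g q) w := by
  refine chartField_eq_of_forall fun v => ?_
  rw [basicPart, chartForm_pullback_cotProj _ hw,
    chartForm_pullback_toSection ζ g (fst_mem_target hw)]
  change chartForm g q (w.1, chartForm ζ.form (cotProj q) w.1)
    (v.1, fderiv ℝ (chartForm ζ.form (cotProj q)) w.1 v.1) = _
  rw [chartForm_apply_eq, flatOmega_apply, flatOmega_apply, graphProj,
    ζ.fderiv_symm _ (fst_mem_target hw) v.1]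
  simp

end BracketInCharts

/-! ### Pull-backs of smooth and of closed one-forms -/

section Pullback

variable {F : Type*} [NormedAddCommGroup F] [NormedSpace ℝ F]
  {H : Type*} [TopologicalSpace H] {J : ModelWithCorners ℝ F H}
  {N : Type*} [TopologicalSpace N] [ChartedSpace H N] [J.Boundaryless] [IsManifold J ∞ N]
  {F' : Type*} [NormedAddCommGroup F'] [NormedSpace ℝ F']
  {H' : Type*} [TopologicalSpace H'] {J' : ModelWithCorners ℝ F' H'}
  {N' : Type*} [TopologicalSpace N'] [ChartedSpace H' N'] [J'.Boundaryless] [IsManifold J' ∞ N']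

/-- The chart on the target is centred at the image point, so the local expression of `φ` exists
only near `y`. An equality of germs is enough for smoothness and closedness. -/
theorem exists_chartForm_pullback_eventuallyEq (a : RoughOneForm J N) {φ : N' → N}
    (hφ : ContMDiff J' J ∞ φ) {q' : N'} {y : F'} (hy : y ∈ (extChartAt J' q').target) :
    ∃ (q : N) (f : F' → F), ContDiffAt ℝ ∞ f y ∧ f y ∈ (extChartAt J q).target ∧
      chartForm (pullbackOneForm (J' := J') φ a) q' =ᶠ[𝓝 y]
        fun z => (chartForm a q (f z)).comp (fderiv ℝ f z) := by
  set q := φ ((extChartAt J' q').symm y) with hq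
  set f := extChartAt J q ∘ φ ∘ (extChartAt J' q').symm with hf
  have hc : ∀ z ∈ (extChartAt J' q').target,
      ContMDiffAt 𝓘(ℝ, F') J ∞ (φ ∘ (extChartAt J' q').symm) z := fun z hz =>
    (hφ _).comp z (contMDiffAt_extChartAt_symm_of_mem q' hz)
  have hfc : ∀ z ∈ (extChartAt J' q').target,
      φ ((extChartAt J' q').symm z) ∈ (extChartAt J q).source → ContDiffAt ℝ ∞ f z := by
    intro z hz hz'
    rw [← contMDiffAt_iff_contDiffAt]
    exact (contMDiffAt_extChartAt_of_mem q hz').comp z (hc z hz)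
  have hev : ∀ᶠ z in 𝓝 y, z ∈ (extChartAt J' q').target ∧
      φ ((extChartAt J' q').symm z) ∈ (extChartAt J q).source :=
    (eventually_mem_extChartAt_target q' hy).and ((hc y hy).continuousAt
      ((isOpen_extChartAt_source q).mem_nhds (mem_extChartAt_source q)))
  refine ⟨q, f, hfc y hy (mem_extChartAt_source q), mem_extChartAt_target q, ?_⟩
  filter_upwards [hev.eventually_nhds] with z hz
  obtain ⟨hz1, hz2⟩ := hz.self_of_nhds
  refine chartForm_pullback a hz1 ((extChartAt J q).map_source hz2)
    ((hfc z hz1 hz2).differentiableAt (by simp)) (hφ.mdifferentiableAt (by simp)) ?_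
  filter_upwards [hz] with t ht
  exact ((extChartAt J q).left_inv ht.2).symm

theorem IsSmoothOneForm.pullback {a : RoughOneForm J N} (ha : IsSmoothOneForm a) {φ : N' → N}
    (hφ : ContMDiff J' J ∞ φ) : IsSmoothOneForm (pullbackOneForm (J' := J') φ a) := by
  refine isSmoothOneForm_iff.2 fun q' y hy => ContDiffAt.contDiffWithinAt ?_
  obtain ⟨q, f, hf, hfy, he⟩ := exists_chartForm_pullback_eventuallyEq a hφ hy
  refine ContDiffAt.congr_of_eventuallyEq ?_ he
  exact ((ha.contDiffAt q hfy).comp y hf).clm_comp (hf.fderiv_right (by simp))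

theorem IsClosedOneForm.pullback {a : RoughOneForm J N} (ha : IsSmoothOneForm a)
    (hac : IsClosedOneForm a) {φ : N' → N} (hφ : ContMDiff J' J ∞ φ) :
    IsClosedOneForm (pullbackOneForm (J' := J') φ a) := by
  refine (isClosedOneForm_iff (ha.pullback hφ)).2 fun q' y hy => ?_
  obtain ⟨q, f, hf, hfy, he⟩ := exists_chartForm_pullback_eventuallyEq a hφ hy
  rw [Filter.EventuallyEq.flatCurl_eq he]
  refine ContinuousLinearMap.ext fun u => ContinuousLinearMap.ext fun v => ?_
  rw [flatCurl_pullback ((ha.contDiffAt q hfy).differentiableAt (by simp))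
    (hf.of_le ENat.LEInfty.out), (isClosedOneForm_iff ha).1 hac q _ hfy]
  rfl

end Pullback

/-! ### Algebraic properties of the bracket of smooth forms -/

section Bracket

open VectorField

variable {E : Type*} [NormedAddCommGroup E] [NormedSpace ℝ E]
  {M : Type*} [TopologicalSpace M] [ChartedSpace E M] [IsManifold 𝓘(ℝ, E) ∞ M]
  {G : Opens (CotangentBundle E M)}

theorem basicPart_add (ζ : ClosedFormIn G) (g g' : FormOn G) :
    basicPart ζ (g + g') = basicPart ζ g + basicPart ζ g' := rfl

theorem basicPart_smul (ζ : ClosedFormIn G) (c : ℝ) (g : FormOn G) :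
    basicPart ζ (c • g) = c • basicPart ζ g := rfl

theorem IsSmoothOneForm.basicPart {g : FormOn G} (hg : IsSmoothOneForm g) (ζ : ClosedFormIn G) :
    IsSmoothOneForm (basicPart ζ g) :=
  (hg.pullback ζ.contMDiff_toSection).pullback contMDiff_cotProj

theorem IsClosedOneForm.basicPart {g : FormOn G} (hg : IsSmoothOneForm g)
    (hgc : IsClosedOneForm g) (ζ : ClosedFormIn G) : IsClosedOneForm (basicPart ζ g) :=
  IsClosedOneForm.pullback (hg.pullback ζ.contMDiff_toSection)
    (IsClosedOneForm.pullback hg hgc ζ.contMDiff_toSection) contMDiff_cotProj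

variable [FiniteDimensional ℝ E]

theorem chartField_formBracket_eventuallyEq {a b : FormOn G} (ha : IsSmoothOneForm a)
    (hb : IsSmoothOneForm b) {q : G} {w : E × (E →L[ℝ] ℝ)}
    (hw : w ∈ (extChartAt (cotangentModel E) q).target) :
    chartField (formBracket a b) q =ᶠ[𝓝 w] lieBracket ℝ (chartField a q) (chartField b q) := by
  filter_upwards [eventually_mem_extChartAt_target q hw] with z hz
  exact chartField_formBracket ha hb hz

theorem IsSmoothOneForm.formBracket {a b : FormOn G} (ha : IsSmoothOneForm a)
    (hb : IsSmoothOneForm b) : IsSmoothOneForm (formBracket a b) := by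
  refine isSmoothOneForm_iff_chartField.2 fun q w hw => ContDiffAt.contDiffWithinAt ?_
  exact ((ha.contDiffAt_chartField q hw).lieBracket_vectorField (hb.contDiffAt_chartField q hw)
    (by simp)).congr_of_eventuallyEq (chartField_formBracket_eventuallyEq ha hb hw)

theorem IsClosedOneForm.formBracket {a b : FormOn G} (ha : IsSmoothOneForm a)
    (hb : IsSmoothOneForm b) (hac : IsClosedOneForm a) (hbc : IsClosedOneForm b) :
    IsClosedOneForm (formBracket a b) := by
  refine (isClosedOneForm_iff (ha.formBracket hb)).2 fun q w hw => ?_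
  have he : chartForm (_root_.formBracket a b) q =ᶠ[𝓝 w]
      fun z => -flatOmega E (lieBracket ℝ (chartField a q) (chartField b q) z) := by
    filter_upwards [eventually_mem_extChartAt_target q hw] with z hz
    rw [chartForm_eq_neg_flatOmega]
    exact congrArg (fun Z => -flatOmega E Z) (chartField_formBracket ha hb hz)
  rw [Filter.EventuallyEq.flatCurl_eq he]
  refine flatCurl_lieBracket_eq_zero (B := flatOmega E) flatOmega_antisymm
    (ha.contDiffAt_chartField q hw) (hb.contDiffAt_chartField q hw) ?_ ?_
  · filter_upwards [eventually_mem_extChartAt_target q hw] with z hz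
    exact (congrArg (fun A => flatCurl A z) (chartForm_eq_neg_flatOmega a q)).symm.trans
      ((isClosedOneForm_iff ha).1 hac q z hz)
  · filter_upwards [eventually_mem_extChartAt_target q hw] with z hz
    exact (congrArg (fun A => flatCurl A z) (chartForm_eq_neg_flatOmega b q)).symm.trans
      ((isClosedOneForm_iff hb).1 hbc q z hz)

/-- The bracket contains derivatives, which are additive only on differentiable forms. So `η` is
bilinear on smooth families and not on arbitrary ones; the same applies to the three lemmas that
follow. -/
theorem formBracket_add_left {a a' b : FormOn G} (ha : IsSmoothOneForm a)
    (ha' : IsSmoothOneForm a') (haa : IsSmoothOneForm (a + a')) (hb : IsSmoothOneForm b) :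
    formBracket (a + a') b = formBracket a b + formBracket a' b := by
  refine formOn_ext fun q w hw => ?_
  have h : chartField (a + a') q = chartField a q + chartField a' q :=
    funext fun z => chartField_add a a' q z
  rw [chartField_add, chartField_formBracket haa hb hw, chartField_formBracket ha hb hw,
    chartField_formBracket ha' hb hw, h, lieBracket_add_left
      ((ha.contDiffAt_chartField q hw).differentiableAt (by simp))
      ((ha'.contDiffAt_chartField q hw).differentiableAt (by simp))]

theorem formBracket_add_right {a b b' : FormOn G} (ha : IsSmoothOneForm a)
    (hb : IsSmoothOneForm b) (hb' : IsSmoothOneForm b') (hbb : IsSmoothOneForm (b + b')) :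
    formBracket a (b + b') = formBracket a b + formBracket a b' := by
  refine formOn_ext fun q w hw => ?_
  have h : chartField (b + b') q = chartField b q + chartField b' q :=
    funext fun z => chartField_add b b' q z
  rw [chartField_add, chartField_formBracket ha hbb hw, chartField_formBracket ha hb hw,
    chartField_formBracket ha hb' hw, h, lieBracket_add_right
      ((hb.contDiffAt_chartField q hw).differentiableAt (by simp))
      ((hb'.contDiffAt_chartField q hw).differentiableAt (by simp))]

theorem formBracket_smul_left (c : ℝ) {a b : FormOn G} (ha : IsSmoothOneForm a)
    (hca : IsSmoothOneForm (c • a)) (hb : IsSmoothOneForm b) :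
    formBracket (c • a) b = c • formBracket a b := by
  refine formOn_ext fun q w hw => ?_
  have h : chartField (c • a) q = c • chartField a q :=
    funext fun z => chartField_smul c a q z
  rw [chartField_smul, chartField_formBracket hca hb hw, chartField_formBracket ha hb hw, h,
    lieBracket_const_smul_left ((ha.contDiffAt_chartField q hw).differentiableAt (by simp))]

theorem formBracket_smul_right (c : ℝ) {a b : FormOn G} (ha : IsSmoothOneForm a)
    (hb : IsSmoothOneForm b) (hcb : IsSmoothOneForm (c • b)) :
    formBracket a (c • b) = c • formBracket a b := by
  refine formOn_ext fun q w hw => ?_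
  have h : chartField (c • b) q = c • chartField b q :=
    funext fun z => chartField_smul c b q z
  rw [chartField_smul, chartField_formBracket ha hcb hw, chartField_formBracket ha hb hw, h,
    lieBracket_const_smul_right ((hb.contDiffAt_chartField q hw).differentiableAt (by simp))]

theorem IsSmoothOneForm.add {a b : FormOn G} (ha : IsSmoothOneForm a) (hb : IsSmoothOneForm b) :
    IsSmoothOneForm (a + b) := by
  refine isSmoothOneForm_iff_chartField.2 fun q => ?_
  refine ((isSmoothOneForm_iff_chartField.1 ha q).add
    (isSmoothOneForm_iff_chartField.1 hb q)).congr fun w _ => chartField_add a b q w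

theorem IsSmoothOneForm.smul (c : ℝ) {a : FormOn G} (ha : IsSmoothOneForm a) :
    IsSmoothOneForm (c • a) := by
  refine isSmoothOneForm_iff_chartField.2 fun q => ?_
  exact ((isSmoothOneForm_iff_chartField.1 ha q).const_smul c).congr
    fun w _ => chartField_smul c a q w

/-- Vector fields that are vertical and constant on the fibres commute. -/
theorem lieBracket_vertical_eq_zero {E P : Type*} [NormedAddCommGroup E] [NormedSpace ℝ E]
    [NormedAddCommGroup P] [NormedSpace ℝ P] (c d : E → P) (w : E × P)
    (hc : DifferentiableAt ℝ (fun w : E × P => ((0 : E), c w.1)) w)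
    (hd : DifferentiableAt ℝ (fun w : E × P => ((0 : E), d w.1)) w) :
    lieBracket ℝ (fun w : E × P => ((0 : E), c w.1)) (fun w : E × P => ((0 : E), d w.1)) w = 0 := by
  -- The field is constant on the line through `w` in a fibre direction, so its derivative in that
  -- direction vanishes. Both terms of the bracket are such derivatives.
  have key : ∀ c : E → P, DifferentiableAt ℝ (fun w : E × P => ((0 : E), c w.1)) w →
      ∀ p : P, fderiv ℝ (fun w : E × P => ((0 : E), c w.1)) w (0, p) = 0 := by
    intro c hc p
    have h1 : HasDerivAt (fun t : ℝ => w + t • ((0 : E), p)) ((0 : E), p) 0 := by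
      simpa using ((hasDerivAt_id (0 : ℝ)).smul_const ((0 : E), p)).const_add w
    have h2 := HasFDerivAt.comp_hasDerivAt (0 : ℝ) (f := fun t : ℝ => w + t • ((0 : E), p))
      (by simpa using hc.hasFDerivAt) h1
    have h3 : (fun w : E × P => ((0 : E), c w.1)) ∘ (fun t : ℝ => w + t • ((0 : E), p)) =
        fun _ => ((0 : E), c w.1) := by
      funext t; simp
    rw [h3] at h2
    exact h2.unique (hasDerivAt_const _ _)
  rw [lieBracket_eq]
  simp only [key c hc, key d hd, sub_zero]

theorem chartField_basicPart_eventuallyEq (ζ : ClosedFormIn G) (g : FormOn G) {q : G}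
    {w : E × (E →L[ℝ] ℝ)} (hw : w ∈ (extChartAt (cotangentModel E) q).target) :
    chartField (basicPart ζ g) q =ᶠ[𝓝 w]
      graphProj (chartForm ζ.form (cotProj q)) (chartField g q) := by
  filter_upwards [eventually_mem_extChartAt_target q hw] with z hz
  exact chartField_basicPart ζ g hz

theorem lieBracket_basicPart {f g : FormOn G} (hf : IsSmoothOneForm f) (hg : IsSmoothOneForm g)
    (ζ : ClosedFormIn G) {q : G} {w : E × (E →L[ℝ] ℝ)}
    (hw : w ∈ (extChartAt (cotangentModel E) q).target) :
    lieBracket ℝ (chartField (basicPart ζ f) q) (chartField (basicPart ζ g) q) w = 0 := by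
  have hf' := ((hf.basicPart ζ).contDiffAt_chartField q hw).congr_of_eventuallyEq
    (chartField_basicPart_eventuallyEq ζ f hw).symm
  have hg' := ((hg.basicPart ζ).contDiffAt_chartField q hw).congr_of_eventuallyEq
    (chartField_basicPart_eventuallyEq ζ g hw).symm
  rw [(chartField_basicPart_eventuallyEq ζ f hw).lieBracket_vectorField_eq
    (chartField_basicPart_eventuallyEq ζ g hw)]
  set z := chartForm ζ.form (cotProj q)
  exact lieBracket_vertical_eq_zero
    (fun y => (chartField f q (y, z y)).2 - fderiv ℝ z y (chartField f q (y, z y)).1)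
    (fun y => (chartField g q (y, z y)).2 - fderiv ℝ z y (chartField g q (y, z y)).1) w
    (hf'.differentiableAt (by simp))
    (hg'.differentiableAt (by simp))

/-- Brackets with basic forms commute with each other. -/
theorem formBracket_basicPart_comm {ξ f g : FormOn G} (hξ : IsSmoothOneForm ξ)
    (hf : IsSmoothOneForm f) (hg : IsSmoothOneForm g) (ζ : ClosedFormIn G) :
    formBracket (formBracket ξ (basicPart ζ f)) (basicPart ζ g) =
      formBracket (formBracket ξ (basicPart ζ g)) (basicPart ζ f) := by
  have hα := hf.basicPart ζ
  have hβ := hg.basicPart ζ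
  refine formOn_ext fun q w hw => ?_
  rw [chartField_formBracket (hξ.formBracket hα) hβ hw,
    chartField_formBracket (hξ.formBracket hβ) hα hw,
    (chartField_formBracket_eventuallyEq hξ hα hw).lieBracket_vectorField_eq
      Filter.EventuallyEq.rfl,
    (chartField_formBracket_eventuallyEq hξ hβ hw).lieBracket_vectorField_eq
      Filter.EventuallyEq.rfl]
  -- In the Jacobi identity for `ξ`, `α`, `β` the term `[ξ, [α, β]]` is zero because basic fields
  -- commute near `w`; what remains is the claim.
  have h1 := leibniz_identity_lieBracket (𝕜 := ℝ) (n := ∞)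
    (by simpa using ENat.LEInfty.out) (hξ.contDiffAt_chartField q hw)
    (hα.contDiffAt_chartField q hw) (hβ.contDiffAt_chartField q hw)
  have h2 : lieBracket ℝ (chartField (basicPart ζ f) q) (chartField (basicPart ζ g) q)
      =ᶠ[𝓝 w] 0 := by
    filter_upwards [eventually_mem_extChartAt_target q hw] with z hz
    exact lieBracket_basicPart hf hg ζ hz
  rw [Filter.EventuallyEq.rfl.lieBracket_vectorField_eq h2, lieBracket_zero_right,
    lieBracket_swap (V := chartField (basicPart ζ f) q)] at h1
  exact sub_eq_zero.1 ((sub_eq_add_neg _ _).trans h1.symm)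

end Bracket

/-! ### Linear combinations of closed one-forms -/

section ClosedForms

variable {F : Type*} [NormedAddCommGroup F] [NormedSpace ℝ F]
  {H : Type*} [TopologicalSpace H] {J : ModelWithCorners ℝ F H}
  {N : Type*} [TopologicalSpace N] [ChartedSpace H N] [J.Boundaryless] [IsManifold J ∞ N]

theorem isClosedOneForm_iff_symm {a : RoughOneForm J N} (ha : IsSmoothOneForm a) :
    IsClosedOneForm a ↔ ∀ q, ∀ y ∈ (extChartAt J q).target, ∀ u v,
      fderiv ℝ (chartForm a q) y u v = fderiv ℝ (chartForm a q) y v u := by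
  rw [isClosedOneForm_iff ha]
  refine forall_congr' fun q => forall₂_congr fun y _ => ⟨fun h u v => ?_, fun h => ?_⟩
  · have h1 := flatCurl_apply (chartForm a q) y u v
    rw [h] at h1
    exact sub_eq_zero.1 h1.symm
  · refine ContinuousLinearMap.ext fun u => ContinuousLinearMap.ext fun v => ?_
    rw [flatCurl_apply, h u v, sub_self]
    rfl

theorem IsClosedOneForm.add_smul {a b : RoughOneForm J N} (ha : IsSmoothOneForm a)
    (hb : IsSmoothOneForm b) (c : ℝ) (hab : IsSmoothOneForm (a + c • b)) (hac : IsClosedOneForm a)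
    (hbc : IsClosedOneForm b) : IsClosedOneForm (a + c • b) := by
  refine (isClosedOneForm_iff_symm hab).2 fun q y hy u v => ?_
  have h : HasFDerivAt (chartForm (a + c • b) q)
      (fderiv ℝ (chartForm a q) y + c • fderiv ℝ (chartForm b q) y) y :=
    ((ha.contDiffAt q hy).differentiableAt (by simp)).hasFDerivAt.add
      (((hb.contDiffAt q hy).differentiableAt (by simp)).hasFDerivAt.const_smul c)
  rw [h.fderiv]
  have h1 := (isClosedOneForm_iff_symm ha).1 hac q y hy u v
  have h2 := (isClosedOneForm_iff_symm hb).1 hbc q y hy u v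
  simp only [add_apply, smul_apply]
  rw [h1, h2]

theorem IsSmoothOneForm.add_smul {a b : RoughOneForm J N} (ha : IsSmoothOneForm a)
    (hb : IsSmoothOneForm b) (c : ℝ) : IsSmoothOneForm (a + c • b) :=
  isSmoothOneForm_iff.2 fun q =>
    (isSmoothOneForm_iff.1 ha q).add ((isSmoothOneForm_iff.1 hb q).const_smul c)

theorem isSmoothOneForm_zero : IsSmoothOneForm (0 : RoughOneForm J N) := by
  refine isSmoothOneForm_iff.2 fun q => ?_
  have h : chartForm (0 : RoughOneForm J N) q = fun _ => 0 := by
    funext y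
    exact ContinuousLinearMap.zero_comp _
  rw [h]
  exact contDiffOn_const

theorem isClosedOneForm_zero : IsClosedOneForm (0 : RoughOneForm J N) := by
  refine (isClosedOneForm_iff_symm isSmoothOneForm_zero).2 fun q y _ u v => ?_
  have h : chartForm (0 : RoughOneForm J N) q = fun _ => 0 := by
    funext y
    exact ContinuousLinearMap.zero_comp _
  rw [h]
  simp

end ClosedForms

/-! ### Algebra of formal expressions for a bilinear `η` -/

section FormalExpressions

variable {V : Type*} [AddCommGroup V] [Module ℝ V] (x : V) (η : V →ₗ[ℝ] V →ₗ[ℝ] V)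

namespace JetExpr

/-- The value of a formal expression in a vector space with a bilinear operation. -/
def evalIn : JetExpr → V
  | gen => x
  | eta f g => η (evalIn f) (evalIn g)
  | add f g => evalIn f + evalIn g
  | smul c f => c • evalIn f

variable {x η}

/-- The pre-Lie identity for the product of formal expressions. -/
theorem evalIn_preLie (hη : ∀ f g, η (η x f) g = η (η x g) f) (f g h : JetExpr) :
    evalIn x η ((f.tri g).tri h) - evalIn x η (f.tri (g.tri h)) =
      evalIn x η ((g.tri f).tri h) - evalIn x η (g.tri (f.tri h)) := by
  induction h with
  | gen =>
    -- The terms `η x (f ▷ g)` cancel in the associator, which leaves `-η (η x f) g`.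
    simp only [tri, evalIn]
    rw [hη (evalIn x η g) (evalIn x η f)]
    abel
  | eta u v hu hv =>
    -- Besides the associators on `u` and on `v`, each side contains `η (f ▷ u) (g ▷ v) + η (g ▷ u)
    -- (f ▷ v)` with a minus sign, which is symmetric in `f` and `g`.
    simp only [tri, evalIn]
    rw [sub_eq_sub_iff_add_eq_add] at hu hv ⊢
    have hu' := congrArg (fun y => η y (evalIn x η v)) hu
    have hv' := congrArg (fun y => η (evalIn x η u) y) hv
    simp only [map_add, LinearMap.add_apply] at hu' hv'
    have h := congrArg₂ (· + ·) hu' hv'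
    rw [← sub_eq_zero] at h ⊢
    rw [← h]
    abel
  | add u v hu hv =>
    simp only [tri, evalIn]
    rw [sub_eq_sub_iff_add_eq_add] at hu hv ⊢
    have h := congrArg₂ (· + ·) hu hv
    rw [← sub_eq_zero] at h ⊢
    rw [← h]
    abel
  | smul c u hu =>
    simp only [tri, evalIn]
    rw [← smul_sub, hu, smul_sub]

/-- The left factor enters the recursion only at the generators, as `η x h`, hence only through its
value. The same reason gives linearity in the left factor. -/
theorem evalIn_tri_congr_left {h h' : JetExpr} (hh : evalIn x η h = evalIn x η h') (e : JetExpr) :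
    evalIn x η (h.tri e) = evalIn x η (h'.tri e) := by
  induction e with
  | gen => simp only [tri, evalIn, hh]
  | eta u v hu hv => simp only [tri, evalIn, hu, hv]
  | add u v hu hv => simp only [tri, evalIn, hu, hv]
  | smul c u hu => simp only [tri, evalIn, hu]

theorem evalIn_tri_add_left (h h' e : JetExpr) :
    evalIn x η ((add h h').tri e) = evalIn x η (h.tri e) + evalIn x η (h'.tri e) := by
  induction e with
  | gen => simp only [tri, evalIn, map_add]
  | eta u v hu hv =>
    simp only [tri, evalIn, hu, hv, map_add, LinearMap.add_apply]
    abel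
  | add u v hu hv =>
    simp only [tri, evalIn, hu, hv]
    abel
  | smul c u hu => simp only [tri, evalIn, hu, smul_add]

theorem evalIn_tri_smul_left (c : ℝ) (h e : JetExpr) :
    evalIn x η ((smul c h).tri e) = c • evalIn x η (h.tri e) := by
  induction e with
  | gen => simp only [tri, evalIn, map_smul]
  | eta u v hu hv => simp only [tri, evalIn, hu, hv, map_smul, LinearMap.smul_apply, smul_add]
  | add u v hu hv => simp only [tri, evalIn, hu, hv, smul_add]
  | smul d u hu => simp only [tri, evalIn, hu, smul_comm c d]

/-- The rules and linearity in the right factor are the recursion of `tri`. This transfers the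
pre-Lie identity from expressions to values and gives uniqueness of the product. -/
theorem triangle_evalIn {T : V →ₗ[ℝ] V →ₗ[ℝ] V} (hT : ∀ h, T h x = η x h)
    (hT' : ∀ h f g, T h (η f g) = η (T h f) g + η f (T h g)) (h e : JetExpr) :
    T (evalIn x η h) (evalIn x η e) = evalIn x η (h.tri e) := by
  induction e with
  | gen => exact hT _
  | eta u v hu hv => rw [tri, evalIn, evalIn, evalIn, evalIn, hT', hu, hv]
  | add u v hu hv => rw [tri, evalIn, evalIn, map_add, hu, hv]
  | smul c u hu => rw [tri, evalIn, evalIn, map_smul, hu]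

theorem preLie_of_evalIn_surjective (hη : ∀ f g, η (η x f) g = η (η x g) f)
    (hs : Function.Surjective (evalIn x η)) {T : V →ₗ[ℝ] V →ₗ[ℝ] V} (hT : ∀ h, T h x = η x h)
    (hT' : ∀ h f g, T h (η f g) = η (T h f) g + η f (T h g)) (f g h : V) :
    T (T f g) h - T f (T g h) = T (T g f) h - T g (T f h) := by
  obtain ⟨f, rfl⟩ := hs f
  obtain ⟨g, rfl⟩ := hs g
  obtain ⟨h, rfl⟩ := hs h
  simp only [triangle_evalIn hT hT']
  exact evalIn_preLie hη f g h

/-- If the product of formal expressions respects equality of values, then there is exactly one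
bilinear product of values that obeys its defining rules. -/
theorem existsUnique_triangle (hs : Function.Surjective (evalIn x η))
    (hwd : ∀ h e e' : JetExpr, evalIn x η e = evalIn x η e' →
      evalIn x η (h.tri e) = evalIn x η (h.tri e')) :
    ∃! T : V →ₗ[ℝ] V →ₗ[ℝ] V, (∀ h, T h x = η x h) ∧
      ∀ h f g, T h (η f g) = η (T h f) g + η f (T h g) := by
  -- `s` chooses an expression for each value. It is not linear, so every law of `T` compares two
  -- expressions of equal value: by `evalIn_tri_congr_left` on the left and by `hwd` on the right.
  obtain ⟨s, hs'⟩ := hs.hasRightInverse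
  let T : V →ₗ[ℝ] V →ₗ[ℝ] V := LinearMap.mk₂ ℝ (fun h f => evalIn x η ((s h).tri (s f)))
    (fun h h' f => by
      rw [← evalIn_tri_add_left]
      exact evalIn_tri_congr_left (by rw [evalIn, hs', hs', hs']) _)
    (fun c h f => by
      rw [← evalIn_tri_smul_left]
      exact evalIn_tri_congr_left (by rw [evalIn, hs', hs']) _)
    (fun h f f' => hwd (s h) (s (f + f')) (.add (s f) (s f')) (by rw [evalIn, hs', hs', hs']))
    (fun c h f => hwd (s h) (s (c • f)) (.smul c (s f)) (by rw [evalIn, hs', hs']))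
  have hT (h e : JetExpr) : T (evalIn x η h) (evalIn x η e) = evalIn x η (h.tri e) :=
    (evalIn_tri_congr_left (hs' _) _).trans (hwd _ _ _ (hs' _))
  refine ⟨T, ⟨fun h => ?_, fun h f g => ?_⟩, fun T' hT' => ?_⟩
  · obtain ⟨h, rfl⟩ := hs h
    exact hT h .gen
  · obtain ⟨h, rfl⟩ := hs h
    obtain ⟨f, rfl⟩ := hs f
    obtain ⟨g, rfl⟩ := hs g
    rw [hT, hT]
    exact hT h (.eta f g)
  · refine LinearMap.ext fun h => LinearMap.ext fun f => ?_
    obtain ⟨h, rfl⟩ := hs h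
    obtain ⟨f, rfl⟩ := hs f
    rw [triangle_evalIn hT'.1 hT'.2, hT]

end JetExpr

end FormalExpressions

/-! ### The space `J_ξ^∞`: smoothness, closedness, bilinearity of `η` -/

section JetSpace

variable {E : Type*} [NormedAddCommGroup E] [NormedSpace ℝ E]
  {M : Type*} [TopologicalSpace M] [ChartedSpace E M] [IsManifold 𝓘(ℝ, E) ∞ M]
  {G : Opens (CotangentBundle E M)} {ξ : FormOn G}

theorem jetSpace_le {p : Submodule ℝ (FormFamily G)} (h : constFamily ξ ∈ p)
    (h' : ∀ f ∈ p, ∀ g ∈ p, etaOp f g ∈ p) : jetSpace ξ ≤ p :=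
  sInf_le ⟨h, h'⟩

/-- The values of expressions form a subspace that contains `ξ` and is stable under `η`, so
minimality of `J_ξ^∞` applies. -/
theorem JetExpr.eval_surjective : Function.Surjective (JetExpr.eval ξ) := by
  let p : Submodule ℝ (FormFamily G) :=
    { carrier := {f | ∃ e : JetExpr, (e.eval ξ : FormFamily G) = f}
      add_mem' := by
        rintro _ _ ⟨e, rfl⟩ ⟨e', rfl⟩
        exact ⟨.add e e', rfl⟩
      -- There is no expression for zero; `0 • ξ` serves instead.
      zero_mem' := ⟨.smul 0 .gen, zero_smul ℝ _⟩
      smul_mem' := by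
        rintro c _ ⟨e, rfl⟩
        exact ⟨.smul c e, rfl⟩ }
  have hp : jetSpace ξ ≤ p := by
    refine jetSpace_le ⟨.gen, rfl⟩ ?_
    rintro _ ⟨e, rfl⟩ _ ⟨e', rfl⟩
    exact ⟨.eta e e', rfl⟩
  intro f
  obtain ⟨e, he⟩ := hp f.2
  exact ⟨e, Subtype.ext he⟩

variable [FiniteDimensional ℝ E]

theorem isSmoothOneForm_of_mem_jetSpace (hξ : IsSmoothOneForm ξ) {f : FormFamily G}
    (hf : f ∈ jetSpace ξ) (ζ : ClosedFormIn G) : IsSmoothOneForm (f ζ) := by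
  let p : Submodule ℝ (FormFamily G) :=
    { carrier := {f | ∀ ζ, IsSmoothOneForm (f ζ)}
      add_mem' := fun hf hg ζ => (hf ζ).add (hg ζ)
      zero_mem' := fun _ => isSmoothOneForm_zero
      smul_mem' := fun c _ hf ζ => (hf ζ).smul c }
  have hp : jetSpace ξ ≤ p :=
    jetSpace_le (fun _ => hξ) fun f hf g hg ζ => (hf ζ).formBracket ((hg ζ).basicPart ζ)
  exact hp hf ζ

/-- Pull-backs and brackets preserve closedness of smooth forms, so smoothness is carried along in
the subspace used for minimality. -/
theorem isClosedOneForm_of_mem_jetSpace (hξ : IsSmoothOneForm ξ) (hξc : IsClosedOneForm ξ)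
    {f : FormFamily G} (hf : f ∈ jetSpace ξ) (ζ : ClosedFormIn G) : IsClosedOneForm (f ζ) := by
  let p : Submodule ℝ (FormFamily G) :=
    { carrier := {f | ∀ ζ, IsSmoothOneForm (f ζ) ∧ IsClosedOneForm (f ζ)}
      add_mem' := fun {f g} hf hg ζ => by
        refine ⟨(hf ζ).1.add (hg ζ).1, ?_⟩
        have h := IsClosedOneForm.add_smul (hf ζ).1 (hg ζ).1 1
          ((hf ζ).1.add_smul (hg ζ).1 1) (hf ζ).2 (hg ζ).2
        rwa [one_smul] at h
      zero_mem' := fun _ => ⟨isSmoothOneForm_zero, isClosedOneForm_zero⟩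
      smul_mem' := fun c f hf ζ => by
        refine ⟨(hf ζ).1.smul c, ?_⟩
        have h := IsClosedOneForm.add_smul isSmoothOneForm_zero (hf ζ).1 c
          (isSmoothOneForm_zero.add_smul (hf ζ).1 c) isClosedOneForm_zero (hf ζ).2
        rwa [zero_add] at h }
  have hp : jetSpace ξ ≤ p :=
    jetSpace_le (fun _ => ⟨hξ, hξc⟩) fun f hf g hg ζ =>
      ⟨(hf ζ).1.formBracket ((hg ζ).1.basicPart ζ), IsClosedOneForm.formBracket (hf ζ).1
        ((hg ζ).1.basicPart ζ) (hf ζ).2 (IsClosedOneForm.basicPart (hg ζ).1 (hg ζ).2 ζ)⟩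
  exact (hp hf ζ).2

theorem etaOp_add_left {f f' g : FormFamily G} (hf : ∀ ζ, IsSmoothOneForm (f ζ))
    (hf' : ∀ ζ, IsSmoothOneForm (f' ζ)) (hg : ∀ ζ, IsSmoothOneForm (g ζ)) :
    etaOp (f + f') g = etaOp f g + etaOp f' g := by
  funext ζ
  rw [Pi.add_apply, etaOp_apply, etaOp_apply, etaOp_apply, Pi.add_apply]
  exact formBracket_add_left (hf ζ) (hf' ζ) ((hf ζ).add (hf' ζ)) ((hg ζ).basicPart ζ)

theorem etaOp_add_right {f g g' : FormFamily G} (hf : ∀ ζ, IsSmoothOneForm (f ζ))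
    (hg : ∀ ζ, IsSmoothOneForm (g ζ)) (hg' : ∀ ζ, IsSmoothOneForm (g' ζ)) :
    etaOp f (g + g') = etaOp f g + etaOp f g' := by
  funext ζ
  rw [Pi.add_apply, etaOp_apply, etaOp_apply, etaOp_apply, Pi.add_apply, basicPart_add]
  exact formBracket_add_right (hf ζ) ((hg ζ).basicPart ζ) ((hg' ζ).basicPart ζ)
    (((hg ζ).basicPart ζ).add ((hg' ζ).basicPart ζ))

theorem etaOp_smul_left (c : ℝ) {f g : FormFamily G} (hf : ∀ ζ, IsSmoothOneForm (f ζ))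
    (hg : ∀ ζ, IsSmoothOneForm (g ζ)) : etaOp (c • f) g = c • etaOp f g := by
  funext ζ
  rw [Pi.smul_apply, etaOp_apply, etaOp_apply, Pi.smul_apply]
  exact formBracket_smul_left c (hf ζ) ((hf ζ).smul c) ((hg ζ).basicPart ζ)

theorem etaOp_smul_right (c : ℝ) {f g : FormFamily G} (hf : ∀ ζ, IsSmoothOneForm (f ζ))
    (hg : ∀ ζ, IsSmoothOneForm (g ζ)) : etaOp f (c • g) = c • etaOp f g := by
  funext ζ
  rw [Pi.smul_apply, etaOp_apply, etaOp_apply, Pi.smul_apply, basicPart_smul]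
  exact formBracket_smul_right c (hf ζ) ((hg ζ).basicPart ζ) (((hg ζ).basicPart ζ).smul c)

theorem etaOp_etaOp_comm {u f g : FormFamily G} (hu : ∀ ζ, IsSmoothOneForm (u ζ))
    (hf : ∀ ζ, IsSmoothOneForm (f ζ)) (hg : ∀ ζ, IsSmoothOneForm (g ζ)) :
    etaOp (etaOp u f) g = etaOp (etaOp u g) f :=
  funext fun ζ => formBracket_basicPart_comm (hu ζ) (hf ζ) (hg ζ) ζ

/-- The operation `η` on `J_ξ^∞` as a bilinear map. -/
def jetSpace.etaLin (hξ : IsSmoothOneForm ξ) : jetSpace ξ →ₗ[ℝ] jetSpace ξ →ₗ[ℝ] jetSpace ξ :=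
  have h (f : jetSpace ξ) := isSmoothOneForm_of_mem_jetSpace hξ f.2
  LinearMap.mk₂ ℝ jetSpace.eta
    (fun f f' g => Subtype.ext (etaOp_add_left (h f) (h f') (h g)))
    (fun c f g => Subtype.ext (etaOp_smul_left c (h f) (h g)))
    (fun f g g' => Subtype.ext (etaOp_add_right (h f) (h g) (h g')))
    (fun c f g => Subtype.ext (etaOp_smul_right c (h f) (h g)))

theorem jetSpace.etaLin_comm (hξ : IsSmoothOneForm ξ) (u f g : jetSpace ξ) :
    jetSpace.etaLin hξ (jetSpace.etaLin hξ u f) g =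
      jetSpace.etaLin hξ (jetSpace.etaLin hξ u g) f :=
  have h (f : jetSpace ξ) := isSmoothOneForm_of_mem_jetSpace hξ f.2
  Subtype.ext (etaOp_etaOp_comm (h u) (h f) (h g))

theorem JetExpr.eval_eq_evalIn (hξ : IsSmoothOneForm ξ) (e : JetExpr) :
    e.eval ξ = e.evalIn (jetSpace.gen ξ) (jetSpace.etaLin hξ) := by
  induction e with
  | gen => rfl
  | eta f g hf hg => exact congrArg₂ jetSpace.eta hf hg
  | add f g hf hg => exact congrArg₂ (fun u v : jetSpace ξ => u + v) hf hg
  | smul c f hf => exact congrArg (fun u : jetSpace ξ => c • u) hf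

end JetSpace

/-! ### Time dependent fields and translation of the fibres -/

section TimeDependent

open VectorField

section Slices

variable {W : Type*} [NormedAddCommGroup W] [NormedSpace ℝ W]

theorem fderiv_slice {A : ℝ × W → W} {t : ℝ} {w : W} (hA : DifferentiableAt ℝ A (t, w)) (v : W) :
    fderiv ℝ A (t, w) (0, v) = fderiv ℝ (fun z => A (t, z)) w v := by
  have h : HasFDerivAt (fun z : W => (t, z)) (ContinuousLinearMap.inr ℝ ℝ W) w :=
    hasFDerivAt_prodMk_right t w
  have h' := HasFDerivAt.comp w hA.hasFDerivAt h
  have h2 : (A ∘ fun z : W => (t, z)) = fun z => A (t, z) := rfl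
  rw [h2] at h'
  rw [h'.fderiv]
  rfl

theorem fderiv_zero_prodMk {X : Type*} [NormedAddCommGroup X] [NormedSpace ℝ X]
    {A : X → W} {x : X} (hA : DifferentiableAt ℝ A x) (v : X) :
    fderiv ℝ (fun x => ((0 : ℝ), A x)) x v = (0, fderiv ℝ A x v) := by
  rw [((hasFDerivAt_const (0 : ℝ) x).prodMk hA.hasFDerivAt).fderiv]
  rfl

/-- The bracket of time dependent vector fields is computed at each time. -/
theorem lieBracket_zero_prodMk {A B : ℝ × W → W} {t : ℝ} {w : W}
    (hA : DifferentiableAt ℝ A (t, w)) (hB : DifferentiableAt ℝ B (t, w)) :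
    lieBracket ℝ (fun x => ((0 : ℝ), A x)) (fun x => ((0 : ℝ), B x)) (t, w) =
      (0, lieBracket ℝ (fun z => A (t, z)) (fun z => B (t, z)) w) := by
  rw [lieBracket_eq, lieBracket_eq]
  simp only [fderiv_zero_prodMk hA, fderiv_zero_prodMk hB, fderiv_slice hA, fderiv_slice hB]
  simp

end Slices

variable {E P : Type*} [NormedAddCommGroup E] [NormedSpace ℝ E] [NormedAddCommGroup P]
    [NormedSpace ℝ P]

/-- The suspension of the vector field on `E × P` that translates the fibres by `d`. -/
def shiftField (d : E → P) (x : ℝ × E × P) : ℝ × E × P := (1, 0, d x.2.1)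

/-- The derivative of a time dependent vector field along `shiftField d`. -/
def shiftDeriv (d : E → P) (X : ℝ × E × P → E × P) (x : ℝ × E × P) : E × P :=
  (lieBracket ℝ (shiftField d) (fun x => ((0 : ℝ), X x)) x).2

/-- The projection `graphProj` along the graph of `z + t • d` at the time `t`. -/
def graphProjAt (z d : E → P) (X : ℝ × E × P → E × P) (x : ℝ × E × P) : E × P :=
  graphProj (z + x.1 • d) (fun w => X (x.1, w)) x.2

variable {z d : E → P} {X Y : ℝ × E × P → E × P} {x : ℝ × E × P}

theorem fderiv_shiftField (hd : DifferentiableAt ℝ d x.2.1) (v : ℝ × E × P) :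
    fderiv ℝ (shiftField d) x v = (0, 0, fderiv ℝ d x.2.1 v.2.1) := by
  have h1 : HasFDerivAt (fun x : ℝ × E × P => x.2.1) ((ContinuousLinearMap.fst ℝ E P).comp
      (ContinuousLinearMap.snd ℝ ℝ (E × P))) x :=
    ((ContinuousLinearMap.fst ℝ E P).comp (ContinuousLinearMap.snd ℝ ℝ (E × P))).hasFDerivAt
  have h2 := HasFDerivAt.comp x hd.hasFDerivAt h1
  have h : HasFDerivAt (shiftField d) _ x :=
    (hasFDerivAt_const (1 : ℝ) x).prodMk ((hasFDerivAt_const (0 : E) x).prodMk h2)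
  rw [h.fderiv]
  rfl

theorem contDiffAt_shiftField (hd : ContDiffAt ℝ ∞ d x.2.1) :
    ContDiffAt ℝ ∞ (shiftField d) x := by
  have h1 : ContDiffAt ℝ ∞ (fun x : ℝ × E × P => x.2.1) x :=
    contDiffAt_fst.comp x contDiffAt_snd
  exact contDiffAt_const.prodMk (contDiffAt_const.prodMk (hd.comp x h1))

theorem lieBracket_shiftField (hd : DifferentiableAt ℝ d x.2.1) (hX : DifferentiableAt ℝ X x) :
    lieBracket ℝ (shiftField d) (fun x => ((0 : ℝ), X x)) x =
      (0, fderiv ℝ X x (shiftField d x) - (0, fderiv ℝ d x.2.1 (X x).1)) := by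
  rw [lieBracket_eq]
  simp only [fderiv_zero_prodMk hX, fderiv_shiftField hd]
  simp

theorem shiftDeriv_eq (hd : DifferentiableAt ℝ d x.2.1) (hX : DifferentiableAt ℝ X x) :
    shiftDeriv d X x = fderiv ℝ X x (shiftField d x) - (0, fderiv ℝ d x.2.1 (X x).1) :=
  congrArg Prod.snd (lieBracket_shiftField hd hX)

theorem ContDiffAt.shiftDeriv (hd : ContDiffAt ℝ ∞ d x.2.1) (hX : ContDiffAt ℝ ∞ X x) :
    ContDiffAt ℝ ∞ (shiftDeriv d X) x :=
  contDiffAt_snd.comp x ((contDiffAt_shiftField hd).lieBracket_vectorField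
    (contDiffAt_const.prodMk hX) (by simp))

theorem graphProjAt_eq (hz : DifferentiableAt ℝ z x.2.1) (hd : DifferentiableAt ℝ d x.2.1) :
    graphProjAt z d X x = (0, (X (x.1, x.2.1, z x.2.1 + x.1 • d x.2.1)).2 -
      (fderiv ℝ z x.2.1 + x.1 • fderiv ℝ d x.2.1) (X (x.1, x.2.1, z x.2.1 + x.1 • d x.2.1)).1) := by
  rw [graphProjAt, graphProj, (hz.hasFDerivAt.add (hd.hasFDerivAt.const_smul x.1)).fderiv]
  rfl

/-- The point of the graph of `z + t • d` over the base point of `x`, at the time `t` of `x`. -/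
def graphPoint (z d : E → P) (x : ℝ × E × P) : ℝ × E × P :=
  (x.1, x.2.1, z x.2.1 + x.1 • d x.2.1)

theorem graphProjAt_congr (h : X (graphPoint z d x) = Y (graphPoint z d x)) :
    graphProjAt z d X x = graphProjAt z d Y x :=
  congrArg (fun v : E × P => ((0 : E), v.2 - fderiv ℝ (z + x.1 • d) x.2.1 v.1)) h

theorem contDiffAt_graphPoint (hz : ContDiffAt ℝ ∞ z x.2.1) (hd : ContDiffAt ℝ ∞ d x.2.1) :
    ContDiffAt ℝ ∞ (graphPoint z d) x := by
  have h1 : ContDiffAt ℝ ∞ (fun x : ℝ × E × P => x.2.1) x :=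
    contDiffAt_fst.comp x contDiffAt_snd
  exact contDiffAt_fst.prodMk (h1.prodMk ((hz.comp x h1).add
    (contDiffAt_fst.smul (hd.comp x h1))))

theorem graphProjAt_eventuallyEq (hz : ContDiffAt ℝ ∞ z x.2.1) (hd : ContDiffAt ℝ ∞ d x.2.1) :
    graphProjAt z d X =ᶠ[𝓝 x] fun x => (0, (X (graphPoint z d x)).2 -
      (fderiv ℝ z x.2.1 + x.1 • fderiv ℝ d x.2.1) (X (graphPoint z d x)).1) := by
  have h1 : Filter.Tendsto (fun x : ℝ × E × P => x.2.1) (𝓝 x) (𝓝 x.2.1) :=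
    (continuous_fst.comp continuous_snd).continuousAt
  filter_upwards [h1.eventually ((hz.of_le (m := 1) ENat.LEInfty.out).eventually (by simp)),
    h1.eventually ((hd.of_le (m := 1) ENat.LEInfty.out).eventually (by simp))] with y hy hy'
  exact graphProjAt_eq (hy.differentiableAt (by simp)) (hy'.differentiableAt (by simp))

theorem ContDiffAt.graphProjAt (hz : ContDiffAt ℝ ∞ z x.2.1) (hd : ContDiffAt ℝ ∞ d x.2.1)
    (hX : ContDiffAt ℝ ∞ X (graphPoint z d x)) : ContDiffAt ℝ ∞ (graphProjAt z d X) x := by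
  refine ContDiffAt.congr_of_eventuallyEq ?_ (graphProjAt_eventuallyEq hz hd)
  have h1 : ContDiffAt ℝ ∞ (fun x : ℝ × E × P => x.2.1) x :=
    contDiffAt_fst.comp x contDiffAt_snd
  have h2 : ContDiffAt ℝ ∞ (fun x => X (graphPoint z d x)) x :=
    hX.comp x (contDiffAt_graphPoint hz hd)
  have hz' : ContDiffAt ℝ ∞ (fun x : ℝ × E × P => fderiv ℝ z x.2.1) x :=
    (hz.fderiv_right (m := ∞) (by simp)).comp x h1
  have hd' : ContDiffAt ℝ ∞ (fun x : ℝ × E × P => fderiv ℝ d x.2.1) x :=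
    (hd.fderiv_right (m := ∞) (by simp)).comp x h1
  exact contDiffAt_const.prodMk ((contDiffAt_snd.comp x h2).sub
    ((hz'.add (contDiffAt_fst.smul hd')).clm_apply (contDiffAt_fst.comp x h2)))

/-- Differentiation along `shiftField d` commutes with the projections along the graphs of
`z + t • d`, as the flow of this field permutes these graphs. -/
theorem shiftDeriv_graphProjAt (hz : ContDiffAt ℝ ∞ z x.2.1) (hd : ContDiffAt ℝ ∞ d x.2.1)
    (hX : ContDiffAt ℝ ∞ X (graphPoint z d x)) :
    shiftDeriv d (graphProjAt z d X) x = graphProjAt z d (shiftDeriv d X) x := by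
  have hz1 := hz.differentiableAt (by simp)
  have hd1 := hd.differentiableAt (by simp)
  have hX1 := hX.differentiableAt (by simp)
  have hQ := (ContDiffAt.graphProjAt hz hd hX).differentiableAt (by simp)
  rw [shiftDeriv_eq hd1 hQ, graphProjAt_eq hz1 hd1, graphProjAt_eq hz1 hd1]
  change fderiv ℝ (graphProjAt z d X) x (shiftField d x) - (0, fderiv ℝ d x.2.1 0) =
    (0, (shiftDeriv d X (graphPoint z d x)).2 -
      (fderiv ℝ z x.2.1 + x.1 • fderiv ℝ d x.2.1) (shiftDeriv d X (graphPoint z d x)).1)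
  rw [shiftDeriv_eq (x := graphPoint z d x) hd1 hX1, map_zero]
  set v := shiftField d x with hv
  set D := fderiv ℝ X (graphPoint z d x) v with hD
  set X₀ := X (graphPoint z d x) with hX₀
  have hc : HasDerivAt (fun s : ℝ => x + s • v) v 0 := by
    simpa using ((hasDerivAt_id (0 : ℝ)).smul_const v).const_add x
  have hq : HasDerivAt (fun s : ℝ => graphProjAt z d X (x + s • v))
      (fderiv ℝ (graphProjAt z d X) x v) 0 :=
    hQ.hasFDerivAt.comp_hasDerivAt_of_eq (0 : ℝ) hc (by simp)
  -- The translation by `s • v` maps the graph at time `x.1` to the graph at time `x.1 + s`. Since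
  -- `shiftField d` depends on the base coordinate only, its value at the graph point is also `v`,
  -- and its integral curves are straight lines.
  have hg (s : ℝ) : graphPoint z d (x + s • v) = graphPoint z d x + s • v := by
    simp [graphPoint, hv, shiftField, add_smul, add_assoc]
  have hXs : HasDerivAt (fun s : ℝ => X (graphPoint z d x + s • v)) D 0 := by
    refine hX1.hasFDerivAt.comp_hasDerivAt_of_eq (0 : ℝ) ?_ (by simp)
    simpa using ((hasDerivAt_id (0 : ℝ)).smul_const v).const_add (graphPoint z d x)
  have hL : HasDerivAt (fun s : ℝ => fderiv ℝ z x.2.1 + (x.1 + s) • fderiv ℝ d x.2.1)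
      (fderiv ℝ d x.2.1) 0 := by
    simpa using (((hasDerivAt_id (0 : ℝ)).const_add x.1).smul_const
      (fderiv ℝ d x.2.1)).const_add (fderiv ℝ z x.2.1)
  have hfst : HasDerivAt (fun s : ℝ => (X (graphPoint z d x + s • v)).1) D.1 0 :=
    (ContinuousLinearMap.fst ℝ E P).hasFDerivAt.comp_hasDerivAt (0 : ℝ) hXs
  have hsnd : HasDerivAt (fun s : ℝ => (X (graphPoint z d x + s • v)).2) D.2 0 :=
    (ContinuousLinearMap.snd ℝ E P).hasFDerivAt.comp_hasDerivAt (0 : ℝ) hXs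
  have hr := (hasDerivAt_const (0 : ℝ) (0 : E)).prodMk (hsnd.sub (hL.clm_apply hfst))
  -- Along this line the projection is explicit in `s`. The product rule differentiates the slope of
  -- the graph too, and this produces the correction term `fderiv ℝ d x.2.1 X₀.1` of `shiftDeriv` on
  -- the other side.
  have he : (fun s : ℝ => graphProjAt z d X (x + s • v)) = fun s : ℝ =>
      ((0 : E), (X (graphPoint z d x + s • v)).2 -
        (fderiv ℝ z x.2.1 + (x.1 + s) • fderiv ℝ d x.2.1)
          (X (graphPoint z d x + s • v)).1) := by
    funext s
    have h1 : (x + s • v).2.1 = x.2.1 := by simp [hv, shiftField]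
    have h2 : (x + s • v).1 = x.1 + s := by simp [hv, shiftField]
    rw [← hg, ← h2, ← h1]
    exact graphProjAt_eq (h1.symm ▸ hz1) (h1.symm ▸ hd1)
  rw [he] at hq
  rw [hq.unique hr]
  change _ = ((0 : E), (D - (0, fderiv ℝ d x.2.1 X₀.1)).2 -
    (fderiv ℝ z x.2.1 + x.1 • fderiv ℝ d x.2.1) (D - (0, fderiv ℝ d x.2.1 X₀.1)).1)
  simp
  abel

/-- The bracket of time dependent vector fields. -/
def sliceBracket (X Y : ℝ × E × P → E × P) (x : ℝ × E × P) : E × P :=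
  lieBracket ℝ (fun w => X (x.1, w)) (fun w => Y (x.1, w)) x.2

theorem lieBracket_zero_prodMk_eventuallyEq (hX : ContDiffAt ℝ ∞ X x) (hY : ContDiffAt ℝ ∞ Y x) :
    lieBracket ℝ (fun x => ((0 : ℝ), X x)) (fun x => ((0 : ℝ), Y x)) =ᶠ[𝓝 x]
      fun x => (0, sliceBracket X Y x) := by
  filter_upwards [(hX.of_le (m := 1) ENat.LEInfty.out).eventually (by simp),
    (hY.of_le (m := 1) ENat.LEInfty.out).eventually (by simp)] with y hy hy'
  exact lieBracket_zero_prodMk (hy.differentiableAt (by simp)) (hy'.differentiableAt (by simp))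

theorem ContDiffAt.sliceBracket (hX : ContDiffAt ℝ ∞ X x) (hY : ContDiffAt ℝ ∞ Y x) :
    ContDiffAt ℝ ∞ (sliceBracket X Y) x := by
  refine ContDiffAt.congr_of_eventuallyEq (f := fun x => (lieBracket ℝ (fun x => ((0 : ℝ), X x))
    (fun x => ((0 : ℝ), Y x)) x).2) ?_ ?_
  · exact contDiffAt_snd.comp x ((contDiffAt_const.prodMk hX).lieBracket_vectorField
      (contDiffAt_const.prodMk hY) (by simp))
  · filter_upwards [lieBracket_zero_prodMk_eventuallyEq hX hY] with y hy
    exact (congrArg Prod.snd hy).symm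

theorem lieBracket_shiftField_eventuallyEq (hd : ContDiffAt ℝ ∞ d x.2.1)
    (hX : ContDiffAt ℝ ∞ X x) :
    lieBracket ℝ (shiftField d) (fun x => ((0 : ℝ), X x)) =ᶠ[𝓝 x]
      fun x => (0, shiftDeriv d X x) := by
  have h1 : Filter.Tendsto (fun x : ℝ × E × P => x.2.1) (𝓝 x) (𝓝 x.2.1) :=
    (continuous_fst.comp continuous_snd).continuousAt
  filter_upwards [(hX.of_le (m := 1) ENat.LEInfty.out).eventually (by simp),
    h1.eventually ((hd.of_le (m := 1) ENat.LEInfty.out).eventually (by simp))] with y hy hy'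
  rw [shiftDeriv_eq (hy'.differentiableAt (by simp)) (hy.differentiableAt (by simp))]
  exact lieBracket_shiftField (hy'.differentiableAt (by simp)) (hy.differentiableAt (by simp))

/-- Differentiation along `shiftField d` is a derivation of the bracket. -/
theorem shiftDeriv_sliceBracket (hd : ContDiffAt ℝ ∞ d x.2.1) (hX : ContDiffAt ℝ ∞ X x)
    (hY : ContDiffAt ℝ ∞ Y x) :
    shiftDeriv d (sliceBracket X Y) x =
      sliceBracket (shiftDeriv d X) Y x + sliceBracket X (shiftDeriv d Y) x := by
  -- Jacobi identity on `ℝ × E × P` for `shiftField d`, `(0, X)` and `(0, Y)`. All brackets that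
  -- occur have zero time component, so the second component is the claim.
  have h := leibniz_identity_lieBracket (𝕜 := ℝ) (n := ∞) (by simpa using ENat.LEInfty.out)
    (contDiffAt_shiftField hd) ((contDiffAt_const (c := (0 : ℝ))).prodMk hX)
    ((contDiffAt_const (c := (0 : ℝ))).prodMk hY)
  rw [Filter.EventuallyEq.rfl.lieBracket_vectorField_eq
      (lieBracket_zero_prodMk_eventuallyEq hX hY),
    (lieBracket_shiftField_eventuallyEq hd hX).lieBracket_vectorField_eq Filter.EventuallyEq.rfl,
    Filter.EventuallyEq.rfl.lieBracket_vectorField_eq (lieBracket_shiftField_eventuallyEq hd hY),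
    (lieBracket_zero_prodMk_eventuallyEq (ContDiffAt.shiftDeriv hd hX) hY).eq_of_nhds,
    (lieBracket_zero_prodMk_eventuallyEq hX (ContDiffAt.shiftDeriv hd hY)).eq_of_nhds] at h
  exact congrArg Prod.snd h

theorem shiftDeriv_congr (h : X =ᶠ[𝓝 x] Y) : shiftDeriv d X x = shiftDeriv d Y x := by
  have h' : (fun x => ((0 : ℝ), X x)) =ᶠ[𝓝 x] fun x => ((0 : ℝ), Y x) := by
    filter_upwards [h] with y hy
    rw [hy]
  exact congrArg Prod.snd (Filter.EventuallyEq.rfl.lieBracket_vectorField_eq h')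

theorem shiftDeriv_add (hd : DifferentiableAt ℝ d x.2.1) (hX : DifferentiableAt ℝ X x)
    (hY : DifferentiableAt ℝ Y x) :
    shiftDeriv d (X + Y) x = shiftDeriv d X x + shiftDeriv d Y x := by
  rw [shiftDeriv_eq hd hX, shiftDeriv_eq hd hY, shiftDeriv_eq hd (hX.add hY), fderiv_add hX hY]
  refine Prod.ext ?_ ?_
  · simp
  · simp
    abel

theorem shiftDeriv_smul (c : ℝ) (hd : DifferentiableAt ℝ d x.2.1) (hX : DifferentiableAt ℝ X x) :
    shiftDeriv d (c • X) x = c • shiftDeriv d X x := by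
  rw [shiftDeriv_eq hd hX, shiftDeriv_eq hd (hX.const_smul c), fderiv_const_smul hX]
  refine Prod.ext ?_ ?_
  · simp
  · simp [smul_sub]

/-- The derivative along `shiftField d` of a field that does not depend on time. -/
theorem shiftDeriv_comp_snd {Z : E × P → E × P} (hd : DifferentiableAt ℝ d x.2.1)
    (hZ : DifferentiableAt ℝ Z x.2) : shiftDeriv d (fun x => Z x.2) x =
      lieBracket ℝ Z (fun w => (0, -d w.1)) x.2 := by
  have h1 : HasFDerivAt (fun x : ℝ × E × P => Z x.2) _ x :=
    HasFDerivAt.comp x hZ.hasFDerivAt (hasFDerivAt_snd (p := x))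
  have h2 : HasFDerivAt (fun w : E × P => ((0 : E), -d w.1)) _ x.2 :=
    (hasFDerivAt_const (0 : E) x.2).prodMk
      (HasFDerivAt.comp x.2 hd.hasFDerivAt (hasFDerivAt_fst (p := x.2))).neg
  rw [shiftDeriv_eq hd h1.differentiableAt, h1.fderiv]
  have h3 : ((0 : E), -d x.2.1) = -((0 : E), d x.2.1) := by simp
  have h4 : ((0 : E), -fderiv ℝ d x.2.1 (Z x.2).1) = -((0 : E), fderiv ℝ d x.2.1 (Z x.2).1) := by
    simp
  change fderiv ℝ Z x.2 (0, d x.2.1) - (0, fderiv ℝ d x.2.1 (Z x.2).1) =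
    fderiv ℝ (fun w : E × P => ((0 : E), -d w.1)) x.2 (Z x.2) - fderiv ℝ Z x.2 (0, -d x.2.1)
  rw [h2.fderiv]
  change fderiv ℝ Z x.2 (0, d x.2.1) - (0, fderiv ℝ d x.2.1 (Z x.2).1) =
    (0, -fderiv ℝ d x.2.1 (Z x.2).1) - fderiv ℝ Z x.2 (0, -d x.2.1)
  rw [h3, h4, map_neg]
  abel

end TimeDependent

/-! ### Cut-off of closed forms and small deformations of `ζ` -/

section CutOff

variable {E : Type*} [NormedAddCommGroup E] [NormedSpace ℝ E]
  {M : Type*} [TopologicalSpace M] [ChartedSpace E M] [IsManifold 𝓘(ℝ, E) ∞ M]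

theorem ContMDiff.contDiffAt_comp_symm {f : M → ℝ} (hf : ContMDiff 𝓘(ℝ, E) 𝓘(ℝ) ∞ f) (x : M)
    {y : E} (hy : y ∈ (extChartAt 𝓘(ℝ, E) x).target) :
    ContDiffAt ℝ ∞ (f ∘ (extChartAt 𝓘(ℝ, E) x).symm) y := by
  rw [← contMDiffAt_iff_contDiffAt]
  exact (hf _).comp y (contMDiffAt_extChartAt_symm_of_mem x hy)

theorem chartForm_diffFun_eventuallyEq {f : M → ℝ} (hf : ContMDiff 𝓘(ℝ, E) 𝓘(ℝ) ∞ f) (x : M)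
    {y : E} (hy : y ∈ (extChartAt 𝓘(ℝ, E) x).target) :
    chartForm (diffFun (J := 𝓘(ℝ, E)) f) x =ᶠ[𝓝 y]
      fderiv ℝ (f ∘ (extChartAt 𝓘(ℝ, E) x).symm) := by
  filter_upwards [eventually_mem_extChartAt_target x hy] with z hz
  exact chartForm_diffFun hz (hf.mdifferentiableAt (by simp))

theorem IsSmoothOneForm.diffFun {f : M → ℝ} (hf : ContMDiff 𝓘(ℝ, E) 𝓘(ℝ) ∞ f) :
    IsSmoothOneForm (diffFun (J := 𝓘(ℝ, E)) f) :=
  isSmoothOneForm_iff.2 fun x _ hy => (((hf.contDiffAt_comp_symm x hy).fderiv_right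
    (by simp)).congr_of_eventuallyEq (chartForm_diffFun_eventuallyEq hf x hy)).contDiffWithinAt

theorem IsClosedOneForm.diffFun {f : M → ℝ} (hf : ContMDiff 𝓘(ℝ, E) 𝓘(ℝ) ∞ f) :
    IsClosedOneForm (diffFun (J := 𝓘(ℝ, E)) f) := by
  refine (isClosedOneForm_iff_symm (.diffFun hf)).2 fun x y hy u v => ?_
  rw [(chartForm_diffFun_eventuallyEq hf x hy).fderiv_eq]
  exact (hf.contDiffAt_comp_symm x hy).isSymmSndFDerivAt (by simpa using ENat.LEInfty.out) u v

/-- Near a point, a closed one-form agrees with a closed one-form of compact support. -/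
theorem exists_isClosedOneForm_eventuallyEq [FiniteDimensional ℝ E] [T2Space M]
    {α : RoughOneForm 𝓘(ℝ, E) M} (hα : IsSmoothOneForm α) (hαc : IsClosedOneForm α) (x₀ : M) :
    ∃ β : RoughOneForm 𝓘(ℝ, E) M, IsSmoothOneForm β ∧ IsClosedOneForm β ∧
      (∃ K : Set M, IsCompact K ∧ ∀ x ∉ K, β x = 0) ∧
      ∀ᶠ y in 𝓝 (extChartAt 𝓘(ℝ, E) x₀ x₀), chartForm β x₀ y = chartForm α x₀ y := by
  set φ := extChartAt 𝓘(ℝ, E) x₀ with hφ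
  obtain ⟨r, hr, hrt⟩ := Metric.mem_nhds_iff.1
    ((isOpen_extChartAt_target (I := 𝓘(ℝ, E)) x₀).mem_nhds (mem_extChartAt_target x₀))
  have hd : DifferentiableOn ℝ (chartForm α x₀) (Metric.ball (φ x₀) r) := fun y hy =>
    ((hα.contDiffAt x₀ (hrt hy)).differentiableAt (by simp)).differentiableWithinAt
  -- The Poincaré lemma on a ball in the chart gives a primitive `g` of the form.
  obtain ⟨g, hg⟩ := (convex_ball (φ x₀) r).exists_forall_hasFDerivAt_of_fderiv_symmetric
    Metric.isOpen_ball hd (fun y hy => (isClosedOneForm_iff_symm hα).1 hαc x₀ y (hrt hy))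
  have hgs : ContDiffOn ℝ ∞ g (Metric.ball (φ x₀) r) := by
    refine (contDiffOn_infty_iff_fderiv_of_isOpen Metric.isOpen_ball).2
      ⟨fun y hy => (hg y hy).differentiableAt.differentiableWithinAt, ?_⟩
    exact ((isSmoothOneForm_iff.1 hα x₀).mono hrt).congr fun y hy => (hg y hy).fderiv
  have hs : φ.source ∩ φ ⁻¹' Metric.ball (φ x₀) r ∈ 𝓝 x₀ :=
    Filter.inter_mem (extChartAt_source_mem_nhds x₀)
      ((continuousAt_extChartAt x₀).preimage_mem_nhds (Metric.ball_mem_nhds _ hr))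
  obtain ⟨f, -, hf⟩ := (SmoothBumpFunction.nhds_basis_tsupport (I := 𝓘(ℝ, E)) x₀).mem_iff.1 hs
  -- The values of `g ∘ φ` away from the ball are arbitrary but are killed by the bump function `f`.
  -- The form `dψ` is closed, is supported in the support of `f`, and equals `α` where `f = 1`.
  set ψ : M → ℝ := fun x => f x * g (φ x) with hψ
  have hψf : tsupport ψ ⊆ tsupport f := tsupport_mul_subset_left
  have hψs : ContMDiff 𝓘(ℝ, E) 𝓘(ℝ) ∞ ψ := by
    refine contMDiff_of_tsupport fun x hx => ?_
    obtain ⟨h1, h2⟩ := hf (hψf hx)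
    have h3 : ContMDiffAt 𝓘(ℝ, E) 𝓘(ℝ) ∞ (g ∘ φ) x :=
      ((hgs.contDiffAt (Metric.isOpen_ball.mem_nhds h2)).contMDiffAt).comp x
        (contMDiffAt_extChartAt_of_mem x₀ h1)
    exact f.contMDiffAt.mul h3
  refine ⟨diffFun ψ, .diffFun hψs, .diffFun hψs, ⟨tsupport f, f.hasCompactSupport, fun x hx => ?_⟩,
    ?_⟩
  · have h0 : ψ =ᶠ[𝓝 x] fun _ => 0 := by
      filter_upwards [(isClosed_tsupport f).isOpen_compl.mem_nhds hx] with y hy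
      rw [hψ]
      simp only
      rw [image_eq_zero_of_notMem_tsupport hy, zero_mul]
    have h1 := h0.mfderiv_eq (I := 𝓘(ℝ, E)) (I' := 𝓘(ℝ))
    rw [mfderiv_const] at h1
    exact h1
  · have h1 : ∀ᶠ y in 𝓝 (φ x₀), f (φ.symm y) = 1 := by
      have h : ContinuousAt φ.symm (φ x₀) := continuousAt_extChartAt_symm (I := 𝓘(ℝ, E)) x₀
      refine h.eventually (p := fun x => f x = 1) ?_
      rw [extChartAt_to_inv]
      exact f.eventuallyEq_one
    have h2 : ψ ∘ φ.symm =ᶠ[𝓝 (φ x₀)] g := by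
      filter_upwards [h1, (isOpen_extChartAt_target x₀).mem_nhds (mem_extChartAt_target x₀)]
        with y hy hy'
      rw [Function.comp_apply, hψ]
      simp only
      rw [hy, one_mul, φ.right_inv hy']
    filter_upwards [chartForm_diffFun_eventuallyEq hψs x₀ (mem_extChartAt_target x₀),
      h2.eventuallyEq_nhds, Metric.ball_mem_nhds _ hr] with y hy hy' hyr
    rw [hy, hy'.fderiv_eq, (hg y hyr).fderiv]

variable {G : Opens (CotangentBundle E M)}

/-- The point depends continuously on time and base point jointly, as seen in a trivialization,
which is linear on fibres. At time zero it lies in the open set `G`. -/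
theorem eventually_graph_mem (ζ : ClosedFormIn G) {β : RoughOneForm 𝓘(ℝ, E) M}
    (hβ : IsSmoothOneForm β) (x : M) : ∀ᶠ y : ℝ × M in 𝓝 (0, x),
      (Bundle.TotalSpace.mk y.2 ((ζ.form + y.1 • β) y.2) : CotangentBundle E M) ∈ G := by
  set s : ℝ × M → CotangentBundle E M := fun y =>
    Bundle.TotalSpace.mk y.2 ((ζ.form + y.1 • β) y.2) with hs
  have h0 : s (0, x) = Bundle.TotalSpace.mk x (ζ.form x) := by
    simp [hs]
  have hc : ContinuousAt s (0, x) := by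
    rw [FiberBundle.continuousAt_totalSpace]
    refine ⟨continuousAt_snd, ?_⟩
    set e := trivializationAt (E →L[ℝ] ℝ) (fun x : M => CotangentSpace 𝓘(ℝ, E) x) x
    have hζ := (ζ.smooth.continuous.continuousAt (x := x))
    have hβ' := (hβ.continuous.continuousAt (x := x))
    rw [FiberBundle.continuousAt_totalSpace] at hζ hβ'
    have h1 : ContinuousAt (fun y : ℝ × M => (e (Bundle.TotalSpace.mk y.2 (ζ.form y.2))).2 +
        y.1 • (e (Bundle.TotalSpace.mk y.2 (β y.2))).2) (0, x) :=
      (ContinuousAt.comp (f := Prod.snd) (x := ((0 : ℝ), x)) hζ.2 continuousAt_snd).add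
        (continuousAt_fst.smul
        (ContinuousAt.comp (f := Prod.snd) (x := ((0 : ℝ), x)) hβ'.2 continuousAt_snd))
    refine h1.congr ?_
    have hb : ∀ᶠ y : ℝ × M in 𝓝 (0, x), y.2 ∈ e.baseSet :=
      continuousAt_snd.eventually (e.open_baseSet.mem_nhds
        (FiberBundle.mem_baseSet_trivializationAt' x))
    filter_upwards [hb] with y hy
    have h2 := (e.linear ℝ hy).map_add (ζ.form y.2) (y.1 • β y.2)
    have h3 := (e.linear ℝ hy).map_smul y.1 (β y.2)
    exact ((h2.trans (congrArg _ h3))).symm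
  exact hc.eventually (G.isOpen.mem_nhds (h0 ▸ ζ.graph_mem x))

/-- Compactness of `K` makes the admissible range of `t` uniform on `K`, and off `K` the form is
still `ζ`. -/
theorem exists_closedFormIn_add_smul (ζ : ClosedFormIn G) {β : RoughOneForm 𝓘(ℝ, E) M}
    (hβ : IsSmoothOneForm β) (hβc : IsClosedOneForm β) {K : Set M} (hK : IsCompact K)
    (hβK : ∀ x ∉ K, β x = 0) :
    ∃ Z : ℝ → ClosedFormIn G, Z 0 = ζ ∧ ∀ᶠ t in 𝓝 (0 : ℝ), (Z t).form = ζ.form + t • β := by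
  classical
  have h := hK.eventually_forall_of_forall_eventually
    (P := fun (t : ℝ) (x : M) => (Bundle.TotalSpace.mk x ((ζ.form + t • β) x) :
      CotangentBundle E M) ∈ G) fun x _ => eventually_graph_mem ζ hβ x
  have h' : ∀ t : ℝ, (∀ x ∈ K, (Bundle.TotalSpace.mk x ((ζ.form + t • β) x) :
      CotangentBundle E M) ∈ G) → ∃ ζ' : ClosedFormIn G, ζ'.form = ζ.form + t • β := by
    intro t ht
    have hs := ζ.smooth.add_smul hβ t
    refine ⟨⟨_, hs, ζ.closed.add_smul ζ.smooth hβ t hs hβc, fun x => ?_⟩, rfl⟩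
    by_cases hx : x ∈ K
    · exact ht x hx
    · have : (ζ.form + t • β) x = ζ.form x := by
        simp [hβK x hx]
      rw [this]
      exact ζ.graph_mem x
  -- The curve has to be defined for all `t`; where `ζ + t • β` leaves `G`, the default value is
  -- `ζ`. The value at `t = 0` is `ζ` by definition.
  refine ⟨fun t => if ht : t ≠ 0 ∧ ∃ ζ' : ClosedFormIn G, ζ'.form = ζ.form + t • β
    then ht.2.choose else ζ, by simp, ?_⟩
  filter_upwards [h] with t ht
  by_cases h0 : t = 0
  · simp [h0]
  · have h1 : t ≠ 0 ∧ ∃ ζ' : ClosedFormIn G, ζ'.form = ζ.form + t • β := ⟨h0, h' t ht⟩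
    rw [dif_pos h1]
    exact h1.2.choose_spec

end CutOff

/-! ### The product as a derivative in the direction of its left factor -/

section TimeFields

open VectorField

variable {E : Type*} [NormedAddCommGroup E] [NormedSpace ℝ E]
  {M : Type*} [TopologicalSpace M] [ChartedSpace E M] [IsManifold 𝓘(ℝ, E) ∞ M]
  {G : Opens (CotangentBundle E M)} {ξ : FormOn G} {Z : ℝ → ClosedFormIn G}
  {z d : E → E →L[ℝ] ℝ} {I : Set ℝ} {q : G} {f g : FormFamily G}

theorem graphPoint_mem (hZ : ∀ t ∈ I, chartForm (Z t).form (cotProj q) = z + t • d)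
    {x : ℝ × E × (E →L[ℝ] ℝ)} (ht : x.1 ∈ I)
    (hx : x.2 ∈ (extChartAt (cotangentModel E) q).target) :
    (graphPoint z d x).2 ∈ (extChartAt (cotangentModel E) q).target := by
  have h := graph_mem_target (Z x.1) q (fst_mem_target hx)
  rwa [hZ _ ht] at h

theorem eventually_mem_prod (hI : IsOpen I) {x : ℝ × E × (E →L[ℝ] ℝ)} (ht : x.1 ∈ I)
    (hx : x.2 ∈ (extChartAt (cotangentModel E) q).target) :
    ∀ᶠ y in 𝓝 x, y.1 ∈ I ∧ y.2 ∈ (extChartAt (cotangentModel E) q).target :=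
  (continuousAt_fst.eventually (hI.mem_nhds ht)).and
    (continuousAt_snd.eventually (eventually_mem_extChartAt_target q hx))

variable [FiniteDimensional ℝ E]

/-- The field in terms of the form on the base, to be compared with the direction `d` of a
deformation. -/
theorem chartField_basicPart_eq (ζ : ClosedFormIn G) (g : FormOn G) {q : G} {w : E × (E →L[ℝ] ℝ)}
    (hw : w ∈ (extChartAt (cotangentModel E) q).target) :
    chartField (basicPart ζ g) q w = (0, -chartForm
      (pullbackOneForm (J' := 𝓘(ℝ, E)) ζ.toSection g) (cotProj q) w.1) := by
  refine chartField_eq_of_forall fun v => ?_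
  rw [basicPart, chartForm_pullback_cotProj _ hw, flatOmega_apply]
  simp

/-- The expression in a chart of a family of one-forms along a curve of closed one-forms, as a
time dependent vector field. -/
def timeField (Z : ℝ → ClosedFormIn G) (q : G) (f : FormFamily G)
    (x : ℝ × E × (E →L[ℝ] ℝ)) : E × (E →L[ℝ] ℝ) :=
  chartField (f (Z x.1)) q x.2

theorem timeField_etaOp (hf : ∀ ζ, IsSmoothOneForm (f ζ)) (hg : ∀ ζ, IsSmoothOneForm (g ζ))
    (hZ : ∀ t ∈ I, chartForm (Z t).form (cotProj q) = z + t • d)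
    {x : ℝ × E × (E →L[ℝ] ℝ)} (ht : x.1 ∈ I)
    (hx : x.2 ∈ (extChartAt (cotangentModel E) q).target) :
    timeField Z q (etaOp f g) x =
      sliceBracket (timeField Z q f) (graphProjAt z d (timeField Z q g)) x := by
  rw [timeField, etaOp_apply, chartField_formBracket (hf _) ((hg _).basicPart _) hx,
    Filter.EventuallyEq.rfl.lieBracket_vectorField_eq
      (chartField_basicPart_eventuallyEq (Z x.1) (g (Z x.1)) hx), hZ _ ht]
  rfl

/-- A family may depend on `ζ` in any way, so smoothness of each `f ζ` says nothing about smoothness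
in time. Joint smoothness comes from the construction of `e` out of the constant family `ξ`, by
induction. -/
theorem JetExpr.contDiffAt_timeField (hξ : IsSmoothOneForm ξ) (hI : IsOpen I)
    (hz : ∀ y ∈ (extChartAt 𝓘(ℝ, E) (cotProj q)).target, ContDiffAt ℝ ∞ z y)
    (hd : ∀ y ∈ (extChartAt 𝓘(ℝ, E) (cotProj q)).target, ContDiffAt ℝ ∞ d y)
    (hZ : ∀ t ∈ I, chartForm (Z t).form (cotProj q) = z + t • d) (e : JetExpr) :
    ∀ x : ℝ × E × (E →L[ℝ] ℝ), x.1 ∈ I → x.2 ∈ (extChartAt (cotangentModel E) q).target →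
      ContDiffAt ℝ ∞ (timeField Z q (e.eval ξ).1) x := by
  have hs (e : JetExpr) := isSmoothOneForm_of_mem_jetSpace hξ (e.eval ξ).2
  induction e with
  | gen =>
    intro x _ hx
    exact (hξ.contDiffAt_chartField q hx).comp x contDiffAt_snd
  | eta f g hf hg =>
    intro x ht hx
    have h : timeField Z q ((JetExpr.eta f g).eval ξ).1 =ᶠ[𝓝 x] sliceBracket
        (timeField Z q (f.eval ξ).1) (graphProjAt z d (timeField Z q (g.eval ξ).1)) := by
      filter_upwards [eventually_mem_prod hI ht hx] with y hy
      exact timeField_etaOp (hs f) (hs g) hZ hy.1 hy.2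
    exact (ContDiffAt.sliceBracket (hf x ht hx) (ContDiffAt.graphProjAt
      (hz _ (fst_mem_target hx)) (hd _ (fst_mem_target hx))
      (hg _ ht (graphPoint_mem hZ ht hx)))).congr_of_eventuallyEq h
  | add f g hf hg =>
    intro x ht hx
    refine ((hf x ht hx).add (hg x ht hx)).congr_of_eventuallyEq (.of_eq ?_)
    exact funext fun x => chartField_add _ _ q x.2
  | smul c f hf =>
    intro x ht hx
    refine ((hf x ht hx).const_smul c).congr_of_eventuallyEq (.of_eq ?_)
    exact funext fun x => chartField_smul c _ q x.2

/-- Differentiation along `shiftField d` is a derivation of the operation `η`. -/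
theorem shiftDeriv_timeField_etaOp (hI : IsOpen I) (hI0 : 0 ∈ I)
    (hz : ∀ y ∈ (extChartAt 𝓘(ℝ, E) (cotProj q)).target, ContDiffAt ℝ ∞ z y)
    (hd : ∀ y ∈ (extChartAt 𝓘(ℝ, E) (cotProj q)).target, ContDiffAt ℝ ∞ d y)
    (hZ : ∀ t ∈ I, chartForm (Z t).form (cotProj q) = z + t • d) {U : Set E} (hU : IsOpen U)
    {f g f' g' : FormFamily G} (hfs : ∀ ζ, IsSmoothOneForm (f ζ)) (hgs : ∀ ζ, IsSmoothOneForm (g ζ))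
    (hfs' : ∀ ζ, IsSmoothOneForm (f' ζ)) (hgs' : ∀ ζ, IsSmoothOneForm (g' ζ))
    (hfc : ∀ x : ℝ × E × (E →L[ℝ] ℝ), x.1 ∈ I → x.2 ∈ (extChartAt (cotangentModel E) q).target →
      ContDiffAt ℝ ∞ (timeField Z q f) x)
    (hgc : ∀ x : ℝ × E × (E →L[ℝ] ℝ), x.1 ∈ I → x.2 ∈ (extChartAt (cotangentModel E) q).target →
      ContDiffAt ℝ ∞ (timeField Z q g) x)
    (hf : ∀ w ∈ (extChartAt (cotangentModel E) q).target, w.1 ∈ U →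
      shiftDeriv d (timeField Z q f) (0, w) = chartField (f' (Z 0)) q w)
    (hg : ∀ w ∈ (extChartAt (cotangentModel E) q).target, w.1 ∈ U →
      shiftDeriv d (timeField Z q g) (0, w) = chartField (g' (Z 0)) q w) :
    ∀ w ∈ (extChartAt (cotangentModel E) q).target, w.1 ∈ U →
      shiftDeriv d (timeField Z q (etaOp f g)) (0, w) =
        chartField (etaOp f' g (Z 0)) q w + chartField (etaOp f g' (Z 0)) q w := by
  intro w hw hwU
  have hev : ∀ᶠ w' in 𝓝 w, w' ∈ (extChartAt (cotangentModel E) q).target ∧ w'.1 ∈ U :=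
    (eventually_mem_extChartAt_target q hw).and
      (continuousAt_fst.eventually (hU.mem_nhds hwU))
  have hdw := hd _ (fst_mem_target hw)
  have hzw := hz _ (fst_mem_target hw)
  have h0 : timeField Z q (etaOp f g) =ᶠ[𝓝 (0, w)] sliceBracket
      (timeField Z q f) (graphProjAt z d (timeField Z q g)) := by
    filter_upwards [eventually_mem_prod (x := (0, w)) hI hI0 hw] with y hy
    exact timeField_etaOp hfs hgs hZ hy.1 hy.2
  have hgp : ContDiffAt ℝ ∞ (graphProjAt z d (timeField Z q g)) (0, w) :=
    ContDiffAt.graphProjAt hzw hdw (hgc (graphPoint z d (0, w)) hI0 (graphPoint_mem (x := (0, w)) hZ hI0 hw))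
  rw [shiftDeriv_congr h0, shiftDeriv_sliceBracket hdw (hfc (0, w) hI0 hw) hgp]
  have h1 : (fun w' => shiftDeriv d (timeField Z q f) (0, w')) =ᶠ[𝓝 w]
      chartField (f' (Z 0)) q := by
    filter_upwards [hev] with w' hw'
    exact hf w' hw'.1 hw'.2
  have h2 (g : FormFamily G) : (fun w' => graphProjAt z d (timeField Z q g) (0, w'))
      =ᶠ[𝓝 w] chartField (basicPart (Z 0) (g (Z 0))) q := by
    refine Filter.EventuallyEq.trans (.of_eq ?_)
      (chartField_basicPart_eventuallyEq (Z 0) (g (Z 0)) hw).symm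
    rw [hZ 0 hI0]
    rfl
  -- `shiftDeriv` is moved inside the projection, where `hg` is needed at the point of the graph
  -- instead of `w'`. That point has the same base coordinate, which is why `U` restricts the base
  -- coordinate only.
  have h3 : (fun w' => shiftDeriv d (graphProjAt z d (timeField Z q g)) (0, w'))
      =ᶠ[𝓝 w] chartField (basicPart (Z 0) (g' (Z 0))) q := by
    refine Filter.EventuallyEq.trans ?_ (h2 g')
    filter_upwards [hev] with w' hw'
    have hm := graphPoint_mem (x := (0, w')) hZ hI0 hw'.1
    have hd' := hd _ (fst_mem_target hw'.1)
    have hz' := hz _ (fst_mem_target hw'.1)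
    exact (shiftDeriv_graphProjAt hz' hd' (hgc (graphPoint z d (0, w')) hI0 hm)).trans
      (graphProjAt_congr (hg _ hm hw'.2))
  have h4 : sliceBracket (shiftDeriv d (timeField Z q f))
      (graphProjAt z d (timeField Z q g)) (0, w) =
      chartField (etaOp f' g (Z 0)) q w := by
    rw [etaOp_apply, chartField_formBracket (hfs' _) ((hgs _).basicPart _) hw]
    exact h1.lieBracket_vectorField_eq (h2 g)
  have h5 : sliceBracket (timeField Z q f)
      (shiftDeriv d (graphProjAt z d (timeField Z q g))) (0, w) =
      chartField (etaOp f g' (Z 0)) q w := by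
    rw [etaOp_apply, chartField_formBracket (hfs _) ((hgs' _).basicPart _) hw]
    exact Filter.EventuallyEq.rfl.lieBracket_vectorField_eq h3
  rw [h4, h5]

/-- The product `h ▷ f` is the derivative of `f` in the direction of `h`. -/
theorem JetExpr.shiftDeriv_timeField (hξ : IsSmoothOneForm ξ) (hI : IsOpen I) (hI0 : 0 ∈ I)
    (hz : ∀ y ∈ (extChartAt 𝓘(ℝ, E) (cotProj q)).target, ContDiffAt ℝ ∞ z y)
    (hd : ∀ y ∈ (extChartAt 𝓘(ℝ, E) (cotProj q)).target, ContDiffAt ℝ ∞ d y)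
    (hZ : ∀ t ∈ I, chartForm (Z t).form (cotProj q) = z + t • d) (h : JetExpr)
    {U : Set E} (hU : IsOpen U)
    (hdU : ∀ y ∈ U, d y = chartForm (pullbackOneForm (J' := 𝓘(ℝ, E)) (Z 0).toSection
      ((h.eval ξ).1 (Z 0))) (cotProj q) y) (e : JetExpr) :
    ∀ w ∈ (extChartAt (cotangentModel E) q).target, w.1 ∈ U →
      shiftDeriv d (timeField Z q (e.eval ξ).1) (0, w) =
        chartField (((h.tri e).eval ξ).1 (Z 0)) q w := by
  have hs (e : JetExpr) := isSmoothOneForm_of_mem_jetSpace hξ (e.eval ξ).2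
  have hc (e : JetExpr) := e.contDiffAt_timeField hξ hI hz hd hZ
  have hev {w : E × (E →L[ℝ] ℝ)} (hw : w ∈ (extChartAt (cotangentModel E) q).target)
      (hwU : w.1 ∈ U) : ∀ᶠ w' in 𝓝 w, w' ∈ (extChartAt (cotangentModel E) q).target ∧ w'.1 ∈ U :=
    (eventually_mem_extChartAt_target q hw).and
      (continuousAt_fst.eventually (hU.mem_nhds hwU))
  induction e with
  | gen =>
    intro w hw hwU
    -- Over `U` the direction `d` is the pull-back of `h` by `ζ`, so the basic field of `h` is `(0,
    -- -d)`. By `shiftDeriv_comp_snd` its bracket with the field of `ξ` is the derivative of the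
    -- constant family.
    have h1 : chartField (basicPart (Z 0) ((h.eval ξ).1 (Z 0))) q =ᶠ[𝓝 w]
        fun w => (0, -d w.1) := by
      filter_upwards [hev hw hwU] with w' hw'
      rw [chartField_basicPart_eq _ _ hw'.1, hdU _ hw'.2]
    have h2 := chartField_formBracket hξ ((hs h (Z 0)).basicPart (Z 0)) hw
    rw [Filter.EventuallyEq.rfl.lieBracket_vectorField_eq h1] at h2
    refine Eq.trans ?_ h2.symm
    exact shiftDeriv_comp_snd (x := (0, w)) ((hd _ (fst_mem_target hw)).differentiableAt (by simp))
      ((hξ.contDiffAt_chartField q hw).differentiableAt (by simp))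
  | eta f g hf hg =>
    intro w hw hwU
    have h1 := shiftDeriv_timeField_etaOp hI hI0 hz hd hZ hU (hs f) (hs g) (hs (h.tri f))
      (hs (h.tri g)) (hc f) (hc g) hf hg w hw hwU
    exact h1.trans (chartField_add _ _ q w).symm
  | add f g hf hg =>
    intro w hw hwU
    have hsum : timeField Z q ((JetExpr.add f g).eval ξ).1 =
        timeField Z q (f.eval ξ).1 + timeField Z q (g.eval ξ).1 :=
      funext fun x => chartField_add _ _ q x.2
    rw [hsum, shiftDeriv_add ((hd _ (fst_mem_target hw)).differentiableAt (by simp))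
      ((hc f (0, w) hI0 hw).differentiableAt (by simp))
      ((hc g (0, w) hI0 hw).differentiableAt (by simp)), hf w hw hwU, hg w hw hwU]
    exact (chartField_add _ _ q w).symm
  | smul c f hf =>
    intro w hw hwU
    have hsum : timeField Z q ((JetExpr.smul c f).eval ξ).1 = c • timeField Z q (f.eval ξ).1 :=
      funext fun x => chartField_smul c _ q x.2
    rw [hsum, shiftDeriv_smul c ((hd _ (fst_mem_target hw)).differentiableAt (by simp))
      ((hc f (0, w) hI0 hw).differentiableAt (by simp)), hf w hw hwU]
    exact (chartField_smul c _ q w).symm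

/-- If `ξ` is closed, the value of `h ▷ f` is determined by the values of `h` and `f`. -/
theorem JetExpr.eval_tri_congr_right [T2Space M] (hξ : IsSmoothOneForm ξ)
    (hξc : IsClosedOneForm ξ) (h : JetExpr) {e e' : JetExpr} (he : e.eval ξ = e'.eval ξ) :
    (h.tri e).eval ξ = (h.tri e').eval ξ := by
  refine Subtype.ext (funext fun ζ => funext fun q => ?_)
  set α : RoughOneForm 𝓘(ℝ, E) M :=
    pullbackOneForm (J' := 𝓘(ℝ, E)) ζ.toSection ((h.eval ξ).1 ζ) with hα
  have hh := isSmoothOneForm_of_mem_jetSpace hξ (h.eval ξ).2 ζ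
  -- Closedness of `ξ` enters here: it makes `α` closed, hence an admissible direction of
  -- deformation of `ζ` after cutting off.
  obtain ⟨β, hβ, hβc, ⟨K, hK, hβK⟩, hβα⟩ := exists_isClosedOneForm_eventuallyEq
    (hh.pullback ζ.contMDiff_toSection) (IsClosedOneForm.pullback hh
      (isClosedOneForm_of_mem_jetSpace hξ hξc (h.eval ξ).2 ζ) ζ.contMDiff_toSection) (cotProj q)
  obtain ⟨Z, hZ0, hZ⟩ := exists_closedFormIn_add_smul ζ hβ hβc hK hβK
  obtain ⟨I, hIs, hI, hI0⟩ := eventually_nhds_iff.1 hZ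
  obtain ⟨U, hUs, hU, hU0⟩ := eventually_nhds_iff.1 hβα
  subst hZ0
  have key (e : JetExpr) := JetExpr.shiftDeriv_timeField (z := chartForm (Z 0).form (cotProj q))
    (d := chartForm β (cotProj q)) (q := q) hξ hI hI0
    (fun y hy => (Z 0).contDiffAt _ hy) (fun y hy => hβ.contDiffAt _ hy)
    (fun t ht => congrArg (fun a => chartForm a (cotProj q)) (hIs t ht)) h hU
    (fun y hy => hUs y hy) e (extChartAt (cotangentModel E) q q) (mem_extChartAt_target q) hU0
  -- The derivative is a function of the family denoted by the expression, so it agrees for `e` and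
  -- `e'`.
  exact eq_of_chartForm_eq (chartField_inj ((key e).symm.trans ((congrArg (fun f : jetSpace ξ =>
    shiftDeriv _ (timeField Z q f.1) _) he).trans (key e'))))

end TimeFields

theorem mainTheorem6
    {E : Type*} [NormedAddCommGroup E] [NormedSpace ℝ E] [FiniteDimensional ℝ E]
    {M : Type*} [TopologicalSpace M] [ChartedSpace E M] [IsManifold 𝓘(ℝ, E) ∞ M] [T2Space M]
    (G : Opens (CotangentBundle E M))
    (hG : ∀ x : M, Bundle.TotalSpace.mk x (0 : CotangentSpace 𝓘(ℝ, E) x) ∈ G)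
    (ξ : FormOn G) (hξ : IsSmoothOneForm ξ) :
    -- `J_ξ^∞` consists of smooth one-forms on `G` (depending on `ζ`), and every element of it
    -- is denoted by a formal expression in `ξ` and `η`
    (∀ f ∈ jetSpace ξ, ∀ ζ, IsSmoothOneForm (f ζ)) ∧
    Function.Surjective (JetExpr.eval ξ) ∧
    -- the pre-Lie identity for the product of expressions
    (∀ f g h : JetExpr,
      JetExpr.eval ξ ((f.tri g).tri h) - JetExpr.eval ξ (f.tri (g.tri h)) =
        JetExpr.eval ξ ((g.tri f).tri h) - JetExpr.eval ξ (g.tri (f.tri h))) ∧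
    -- the pre-Lie identity for any bilinear product on `J_ξ^∞` that obeys the defining rules
    (∀ T : jetSpace ξ →ₗ[ℝ] jetSpace ξ →ₗ[ℝ] jetSpace ξ, IsTriangleProduct T →
      ∀ f g h, T (T f g) h - T f (T g h) = T (T g f) h - T g (T f h)) ∧
    -- if `ξ` is closed, there is exactly one such product
    (IsClosedOneForm ξ →
      ∃! T : jetSpace ξ →ₗ[ℝ] jetSpace ξ →ₗ[ℝ] jetSpace ξ, IsTriangleProduct T) := by
  have hev : JetExpr.eval ξ = JetExpr.evalIn (jetSpace.gen ξ) (jetSpace.etaLin hξ) :=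
    funext (JetExpr.eval_eq_evalIn hξ)
  have hs : Function.Surjective (JetExpr.evalIn (jetSpace.gen ξ) (jetSpace.etaLin hξ)) :=
    hev ▸ JetExpr.eval_surjective
  refine ⟨fun f hf ζ => isSmoothOneForm_of_mem_jetSpace hξ hf ζ, JetExpr.eval_surjective,
    fun f g h => ?_, fun T hT => ?_, fun hξc => ?_⟩
  · rw [hev]
    exact JetExpr.evalIn_preLie (jetSpace.etaLin_comm hξ _) f g h
  · exact JetExpr.preLie_of_evalIn_surjective (jetSpace.etaLin_comm hξ _) hs hT.1 hT.2
  · exact JetExpr.existsUnique_triangle hs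
      (hev ▸ fun h _ _ he => JetExpr.eval_tri_congr_right hξ hξc h he)

end
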